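/- **Setting (two-level stochastic regularized gradient method, MU$^2$STREG).** Let $f:\mathbb R^n\to\mathbb R$, $n_c\le n$, $x_0\in\mathbb R^n$, $\lambda_0>0$, $\eta_1,\gamma\in(0,1)$, $\eta_2>0$, and $X_0=x_0$, $\Lambda_0=\lambda_0$. On a probability space, at each iteration $k\ge 0$, write $x_k,\lambda_k,\dots$ for the realizations of $X_k,\Lambda_k,\dots$. The method draws a linear map $R_k:\mathbb R^n\to\mathbb R^{n_c}$, sets $P_k=R_k^T$, takes an approximation $g_k$ of $\nabla f(x_k)$ and a function $\phi_k:\mathbb R^{n_c}\to\mathbb R$, and chooses one of two trial steps: * fine step: $s_k=-\dfrac{g_k}{\lambda_k\|g_k\|}$ (with $s_k=0$ if $g_k=0$); the predicted reduction is $m_k^0-m_k^s=m_k(x_k)-m_k(x_k+s_k)$ with the fine model $m_k(x_k+s)=f_k+g_k^Ts$; * coarse step (allowed only if $\|R_kg_k\|\ge\kappa_H\|g_k\|$): $s_k=P_ks^*$, where, with $\varphi_k(s)=\phi_k(R_kx_k+s)+(R_kg_k-\nabla\phi_k(R_kx_k))^Ts$ and $m_k^R(s)=\varphi_k(s)+\frac{\lambda_k\|g_k\|}{2}\|s\|^2$,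 the point $s^*\in\mathbb R^{n_c}$ satisfies $m_k^R(s^*)\le m_k^R(0)$ and $\|\nabla m_k^R(s^*)\|\le\theta\|s^*\|$; the predicted reduction is $m_k^0-m_k^s=\varphi_k(0)-\varphi_k(s^*)$. Given real estimates $f_k$, $f_k^s$ of $f(x_k)$, $f(x_k+s_k)$, put $\rho_k=(f_k-f_k^s)/(m_k^0-m_k^s)$. If $\rho_k\ge\eta_1$ and $\|g_k\|\ge\eta_2/\lambda_k$, set $x_{k+1}=x_k+s_k$, $\lambda_{k+1}=\gamma\lambda_k$; otherwise $x_{k+1}=x_k$, $\lambda_{k+1}=\gamma^{-1}\lambda_k$. The method is run for all $k$ (no stopping test). Capital letters $X_k,\Lambda_k,S_k,F_k,F_k^s$ denote the corresponding random quantities. Let $\mathcal F_{k-1}$ be the $\sigma$-algebra generated by the models ($g_j$, $R_j$, the choice of the step, $\phi_j$, $s^*_j$) and the estimates $(F_j,F_j^s)$ of the iterations $j<k$, and let $\mathcal F_{k-1/2}$ be generated by $\mathcal F_{k-1}$ and the model quantities ($g_k,R_k$, choice of the step, $\phi_k,s^*_k$) of iteration $k$. **Assumptions.** 1. $\theta,\kappa_R>0$,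 $\kappa_H\in(0,1)$, and $\kappa_H<\|R_k\|\le\kappa_R$ for all $k$ and all realizations. 2. $f$ and, for all $k$ and all realizations, $\phi_k$ are continuously differentiable and bounded from below, $\nabla f$ is $L_f$-Lipschitz and $\nabla\phi_k$ is $L_\phi$-Lipschitz, with constants $L_f,L_\phi\ge 0$. 3. $\kappa_f,\kappa_g\ge0$, $\epsilon_f>0$, $\eta_2\ge\max\{L_\phi+\theta,\,24\kappa_f\}$ and $\epsilon_f\le\min\{\kappa_f,\ \eta_1\eta_2\kappa_H^2/32\}$. 4. For given $\alpha,\beta\in(0,1)$ and all $k$, almost surely $\mathbb P(I_k\mid\mathcal F_{k-1})\ge\alpha$ and $\mathbb P(J_k\mid\mathcal F_{k-1/2})\ge\beta$. Here $I_k$ is the event that the fine model $m_k$ satisfies $\|\nabla f(y)-\nabla m_k(y)\|\le\kappa_g/\Lambda_k$ and $|f(y)-m_k(y)|\le\kappa_f/\Lambda_k^2$ for all $y$ in some neighbourhood of $X_k$, and $J_k$ is the event that $|F_k-f(X_k)|\le\epsilon_f/\Lambda_k^2$ and $|F_k^s-f(X_k+S_k)|\le\epsilon_f/\Lambda_k^2$.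 **Theorem.** Let the constants $\eta_1,\eta_2,\gamma,\theta,\kappa_H,\kappa_R,L_f,L_\phi,\kappa_f,\kappa_g,\epsilon_f$ be as in the setting and in 1–3. There are $\alpha_0,\beta_0\in(0,1)$, depending only on these constants, such that whenever 1–4 hold with some $\alpha\in[\alpha_0,1)$ and $\beta\in[\beta_0,1)$, then almost surely $$\lim_{k\to\infty}\|\nabla f(X_k)\|=0 .$$ -/

import Mathlib

open MeasureTheory ProbabilityTheory Filter Topology
open scoped NNReal RealInnerProductSpace

universe u

namespace MU2STREG

noncomputable section

/-- `ℝⁿ` with the Euclidean norm. -/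
abbrev Vec (n : ℕ) := EuclideanSpace ℝ (Fin n)

/-- The deterministic constants: the algorithmic ones, those bounding the transfer operators and
the inexactness of the coarse solve, the Lipschitz constants of the gradients of the objective and
of the coarse functions, and the accuracy constants of the models and of the estimates. -/
structure Constants where
  eta1 : ℝ
  eta2 : ℝ
  gamma : ℝ
  theta : ℝ
  kappaH : ℝ
  kappaR : ℝ
  Lf : ℝ≥0
  Lphi : ℝ≥0
  kappaf : ℝ
  kappag : ℝ
  epsf : ℝ

/-- The ranges of the constants and the conditions linking them. -/
structure Constants.Admissible (c : Constants) : Prop where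
  eta1_pos : 0 < c.eta1
  eta1_lt_one : c.eta1 < 1
  eta2_pos : 0 < c.eta2
  gamma_pos : 0 < c.gamma
  gamma_lt_one : c.gamma < 1
  theta_pos : 0 < c.theta
  kappaH_pos : 0 < c.kappaH
  kappaH_lt_one : c.kappaH < 1
  kappaR_pos : 0 < c.kappaR
  kappaf_nonneg : 0 ≤ c.kappaf
  kappag_nonneg : 0 ≤ c.kappag
  epsf_pos : 0 < c.epsf
  eta2_ge : max ((c.Lphi : ℝ) + c.theta) (24 * c.kappaf) ≤ c.eta2
  epsf_le : c.epsf ≤ min c.kappaf (c.eta1 * c.eta2 * c.kappaH ^ 2 / 32)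

/-- The affine fine-level model `m(x + s) = fk + gᵀ s`, as a function of `y = x + s`. -/
def fineModel {n : ℕ} (fk : ℝ) (g x : Vec n) (y : Vec n) : ℝ := fk + ⟪g, y - x⟫

/-- The corrected coarse model `φ(R x + s) + (R g - ∇φ(R x))ᵀ s`. -/
def coarseModel {n nc : ℕ} (phi : Vec nc → ℝ) (R : Vec n →L[ℝ] Vec nc) (g x : Vec n)
    (s : Vec nc) : ℝ :=
  phi (R x + s) + ⟪R g - gradient phi (R x), s⟫

/-- The regularized coarse model. -/
def regCoarseModel {n nc : ℕ} (phi : Vec nc → ℝ) (R : Vec n →L[ℝ] Vec nc) (g x : Vec n)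
    (lam : ℝ) (s : Vec nc) : ℝ :=
  coarseModel phi R g x s + lam * ‖g‖ / 2 * ‖s‖ ^ 2

/-- Everything that is drawn, chosen or computed inexactly during one iteration: whether the coarse
step is used, the restriction operator `R` (the prolongation is its transpose), the gradient
approximation `g`, the coarse function `phi`, the approximate minimizer `sStar` of the regularized
coarse model, and the estimates `fk`, `fks` of the objective at the current and at the trial
point. If the fine step is used, then `phi` and `sStar` play no role. -/
structure IterData (n nc : ℕ) where
  coarse : Bool
  R : Vec n →L[ℝ] Vec nc
  g : Vec n
  phi : Vec nc → ℝ
  sStar : Vec nc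
  fk : ℝ
  fks : ℝ

namespace IterData

variable {n nc : ℕ}

/-- The trial step: `P sStar` with `P = Rᵀ` (coarse) or `- g / (lam ‖g‖)` (fine; this is `0` if
`g = 0`, in which case the iteration is unsuccessful whatever the step is). -/
def step (d : IterData n nc) (lam : ℝ) : Vec n :=
  if d.coarse then (ContinuousLinearMap.adjoint d.R) d.sStar
  else -((1 / (lam * ‖d.g‖)) • d.g)

/-- The predicted reduction `m⁰ - mˢ`. -/
def predictedReduction (d : IterData n nc) (x : Vec n) (lam : ℝ) : ℝ :=
  if d.coarse then coarseModel d.phi d.R d.g x 0 - coarseModel d.phi d.R d.g x d.sStar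
  else fineModel d.fk d.g x x - fineModel d.fk d.g x (x + d.step lam)

/-- The ratio of achieved to predicted reduction. -/
def rho (d : IterData n nc) (x : Vec n) (lam : ℝ) : ℝ :=
  (d.fk - d.fks) / d.predictedReduction x lam

/-- The acceptance test. -/
def Successful (d : IterData n nc) (c : Constants) (x : Vec n) (lam : ℝ) : Prop :=
  c.eta1 ≤ d.rho x lam ∧ c.eta2 / lam ≤ ‖d.g‖

open Classical in
/-- One iteration of the algorithm: the new iterate and the new regularization parameter. -/
def next (d : IterData n nc) (c : Constants) (xl : Vec n × ℝ) : Vec n × ℝ :=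
  if d.Successful c xl.1 xl.2 then (xl.1 + d.step xl.2, c.gamma * xl.2)
  else (xl.1, c.gamma⁻¹ * xl.2)

/-- The requirements under which the coarse step may be used, and those on the approximate
minimizer `sStar`. -/
def CoarseStepValid (d : IterData n nc) (c : Constants) (x : Vec n) (lam : ℝ) : Prop :=
  c.kappaH * ‖d.g‖ ≤ ‖d.R d.g‖ ∧
  regCoarseModel d.phi d.R d.g x lam d.sStar ≤ regCoarseModel d.phi d.R d.g x lam 0 ∧
  ‖gradient (regCoarseModel d.phi d.R d.g x lam) d.sStar‖ ≤ c.theta * ‖d.sStar‖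

end IterData

section RandomProcess

variable {Ω : Type u} {n nc : ℕ}

/-- The pair (iterate, regularization parameter) generated by the algorithm from `(x0, lam0)`. -/
def state (c : Constants) (x0 : Vec n) (lam0 : ℝ) (D : ℕ → Ω → IterData n nc) :
    ℕ → Ω → Vec n × ℝ
  | 0, _ => (x0, lam0)
  | k + 1, ω => (D k ω).next c (state c x0 lam0 D k ω)

/-- The random iterates `X_k`. -/
def X (c : Constants) (x0 : Vec n) (lam0 : ℝ) (D : ℕ → Ω → IterData n nc) (k : ℕ) (ω : Ω) :
    Vec n := (state c x0 lam0 D k ω).1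

/-- The random regularization parameters `Λ_k`. -/
def Lam (c : Constants) (x0 : Vec n) (lam0 : ℝ) (D : ℕ → Ω → IterData n nc) (k : ℕ) (ω : Ω) :
    ℝ := (state c x0 lam0 D k ω).2

/-- The random trial steps `S_k`. -/
def S (c : Constants) (x0 : Vec n) (lam0 : ℝ) (D : ℕ → Ω → IterData n nc) (k : ℕ) (ω : Ω) :
    Vec n := (D k ω).step (Lam c x0 lam0 D k ω)

/-- The `σ`-algebra generated by the random model of one iteration (gradient approximation,
transfer operator, choice of the step, coarse function with the `σ`-algebra of its point
evaluations, coarse step). The constant term `fk` of the fine model is also the function estimate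
and is counted among the estimates. -/
@[reducible] def modelSigma (d : Ω → IterData n nc) : MeasurableSpace Ω :=
  MeasurableSpace.comap (fun ω => (d ω).coarse) inferInstance ⊔
  MeasurableSpace.comap (fun ω => (d ω).R) inferInstance ⊔
  MeasurableSpace.comap (fun ω => (d ω).g) inferInstance ⊔
  MeasurableSpace.comap (fun ω => (d ω).phi) inferInstance ⊔
  MeasurableSpace.comap (fun ω => (d ω).sStar) inferInstance

/-- The `σ`-algebra generated by the function estimates of one iteration. -/
@[reducible] def estimateSigma (d : Ω → IterData n nc) : MeasurableSpace Ω :=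
  MeasurableSpace.comap (fun ω => (d ω).fk) inferInstance ⊔
  MeasurableSpace.comap (fun ω => (d ω).fks) inferInstance

/-- The `σ`-algebra of the models and estimates of the iterations `0, …, k - 1`. -/
@[reducible] def past (D : ℕ → Ω → IterData n nc) (k : ℕ) : MeasurableSpace Ω :=
  ⨆ j : Fin k, modelSigma (D j) ⊔ estimateSigma (D j)

/-- The `σ`-algebra of the models of the iterations `0, …, k` and of the estimates of the
iterations `0, …, k - 1`. -/
@[reducible] def pastHalf (D : ℕ → Ω → IterData n nc) (k : ℕ) : MeasurableSpace Ω :=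
  past D k ⊔ modelSigma (D k)

/-- The function `m` is a `(kappaf, kappag)`-fully linear model of `f` around `x`, for the
regularization parameter `lam`: both bounds hold on some neighbourhood of `x`. -/
def FullyLinear (kappaf kappag : ℝ) (f m : Vec n → ℝ) (x : Vec n) (lam : ℝ) : Prop :=
  ∀ᶠ y in 𝓝 x, ‖gradient f y - gradient m y‖ ≤ kappag / lam ∧ |f y - m y| ≤ kappaf / lam ^ 2

/-- The values `fk`, `fks` are `epsf`-accurate estimates of `f x`, `f (x + s)`. -/
def AccurateEstimates (epsf : ℝ) (f : Vec n → ℝ) (x s : Vec n) (lam fk fks : ℝ) : Prop :=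
  |fk - f x| ≤ epsf / lam ^ 2 ∧ |fks - f (x + s)| ≤ epsf / lam ^ 2

/-- The random fine models are `α`-probabilistically fully linear. -/
def ProbFullyLinear [MeasurableSpace Ω] (μ : Measure Ω) (α : ℝ) (c : Constants)
    (f : Vec n → ℝ) (x0 : Vec n) (lam0 : ℝ) (D : ℕ → Ω → IterData n nc) : Prop :=
  ∀ k, ∀ᵐ ω ∂μ, α ≤
    (μ⟦{ω' | FullyLinear c.kappaf c.kappag f
          (fineModel (D k ω').fk (D k ω').g (X c x0 lam0 D k ω'))
          (X c x0 lam0 D k ω') (Lam c x0 lam0 D k ω')} | past D k⟧) ω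

/-- The random estimates are `β`-probabilistically accurate. -/
def ProbAccurate [MeasurableSpace Ω] (μ : Measure Ω) (β : ℝ) (c : Constants)
    (f : Vec n → ℝ) (x0 : Vec n) (lam0 : ℝ) (D : ℕ → Ω → IterData n nc) : Prop :=
  ∀ k, ∀ᵐ ω ∂μ, β ≤
    (μ⟦{ω' | AccurateEstimates c.epsf f (X c x0 lam0 D k ω') (S c x0 lam0 D k ω')
          (Lam c x0 lam0 D k ω') (D k ω').fk (D k ω').fks} | pastHalf D k⟧) ω

/-- The assumptions on the steps: the bounds on the transfer operators hold, and the coarse step is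
used only where it is allowed, with an admissible approximate minimizer. -/
structure StepAssumptions (c : Constants) (x0 : Vec n) (lam0 : ℝ)
    (D : ℕ → Ω → IterData n nc) : Prop where
  kappaH_lt : ∀ k ω, c.kappaH < ‖(D k ω).R‖
  norm_R_le : ∀ k ω, ‖(D k ω).R‖ ≤ c.kappaR
  coarse_valid : ∀ k ω, (D k ω).coarse = true →
    (D k ω).CoarseStepValid c (X c x0 lam0 D k ω) (Lam c x0 lam0 D k ω)

/-- The regularity assumptions on the objective and on the coarse functions. -/
structure SmoothnessAssumptions (c : Constants) (f : Vec n → ℝ)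
    (D : ℕ → Ω → IterData n nc) : Prop where
  dim_le : nc ≤ n
  contDiff_f : ContDiff ℝ 1 f
  bddBelow_f : BddBelow (Set.range f)
  lipschitz_f : LipschitzWith c.Lf (gradient f)
  contDiff_phi : ∀ k ω, ContDiff ℝ 1 (D k ω).phi
  bddBelow_phi : ∀ k ω, BddBelow (Set.range (D k ω).phi)
  lipschitz_phi : ∀ k ω, LipschitzWith c.Lphi (gradient (D k ω).phi)

end RandomProcess

end

end MU2STREG

open MU2STREG

/-!
Write `δ = 1 / λ`, `h = ‖∇f(x)‖`. In an iteration which passes the test `η₂ δ ≤ ‖g‖`, a fine and a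
coarse step behave alike: the step has length `O(δ)`, the predicted reduction is at least a fixed
multiple of `‖g‖ δ`, and it agrees with `-gᵀ s` up to `O(δ ^ 2)`. For the coarse step this uses the
decrease of the regularized model, its approximate stationarity, and the first-order correction of
the coarse function (`Regular.norm_step_le`, `Regular.le_predictedReduction`,
`Regular.abs_predictedReduction_add_inner_le`).

The analysis rests on the potential `f(x) + τ δ ^ 2`. If the function estimates are accurate, it
decreases by at least a multiple of `δ ^ 2`, whatever the model: a rejected step shrinks `δ`, and
the acceptance test guarantees a decrease of `f` exceeding the estimation errors. If moreover the
gradient is accurate and `h ≥ ζ δ`, then the step is accepted and the decrease is at least a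
multiple of `h δ`. In any case the increase is at most a multiple of the same weight, which is
`h δ` if `h ≥ ζ δ` and `δ ^ 2` otherwise (`potential_state_succ_sub_le`). As the weight is
determined by the past, and inaccuracy has small conditional probability, the potential decreases in
expectation by a multiple of the weight. The objective being bounded below, the weights are almost
surely summable (`ae_summable_weight`). Hence `δ → 0`, and `δ` is summable over the iterations
where `h` exceeds a given level.

It remains to work along a trajectory. The walk which goes up in the accurate iterations and down
in the others is a submartingale with steps `±1`, and so almost surely unbounded above
(`ae_not_bddAbove_walk`). If `h` stayed away from zero, all accurate iterations would eventually be
successful and `log δ` would dominate a multiple of the walk, contrary to `δ → 0`; so `h` comes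
arbitrarily close to zero infinitely often (`frequently_norm_gradient_lt`). Finally `h` changes by
`O(δ)` in one iteration, and for every `ε > 0` the sum of `δ` over the iterations with `h ≥ ε` is
finite, so `max h ε` has finite variation and can only converge to `ε`
(`tendsto_zero_of_summable_indicator`).
-/

namespace MU2STREG

noncomputable section

/-! ### First-order expansions and the coarse model -/

lemma inner_gradient_eq_fderiv {m : ℕ} (phi : Vec m → ℝ) (y s : Vec m) :
    ⟪gradient phi y, s⟫ = fderiv ℝ phi y s := by
  rw [gradient, InnerProductSpace.toDual_symm_apply]

lemma abs_sub_sub_inner_gradient_le {m : ℕ} {phi : Vec m → ℝ} {L : ℝ≥0}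
    (hd : Differentiable ℝ phi) (hL : LipschitzWith L (gradient phi)) (y s : Vec m) :
    |phi (y + s) - phi y - ⟪gradient phi y, s⟫| ≤ L / 2 * ‖s‖ ^ 2 := by
  have hder : ∀ t : ℝ, HasDerivAt (fun t : ℝ => phi (y + t • s) - phi y - t * ⟪gradient phi y, s⟫)
      (⟪gradient phi (y + t • s), s⟫ - ⟪gradient phi y, s⟫) t := by
    intro t
    have h1 : HasDerivAt (fun t : ℝ => y + t • s) s t := by
      simpa using ((hasDerivAt_id t).smul_const s).const_add y
    have h2 := (hd (y + t • s)).hasFDerivAt.comp_hasDerivAt t h1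
    rw [← inner_gradient_eq_fderiv] at h2
    have h3 := (h2.sub_const (phi y)).sub ((hasDerivAt_id t).mul_const ⟪gradient phi y, s⟫)
    rw [one_mul] at h3
    exact h3
  have hB : ∀ t : ℝ, HasDerivAt (fun t : ℝ => (L : ℝ) / 2 * ‖s‖ ^ 2 * t ^ 2)
      (L * ‖s‖ ^ 2 * t) t := by
    intro t
    have := (hasDerivAt_pow 2 t).const_mul ((L : ℝ) / 2 * ‖s‖ ^ 2)
    refine this.congr_deriv ?_
    push_cast
    ring
  have key := image_norm_le_of_norm_deriv_right_le_deriv_boundary (a := 0) (b := 1)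
    (fun t _ => (hder t).continuousAt.continuousWithinAt)
    (fun t _ => (hder t).hasDerivWithinAt) (by simp) hB
    (fun t ht => by
      rw [← inner_sub_left]
      refine (norm_inner_le_norm _ _).trans ?_
      have := hL.norm_sub_le (y + t • s) y
      rw [add_sub_cancel_left, norm_smul, Real.norm_of_nonneg ht.1] at this
      calc _ ≤ (L * (t * ‖s‖)) * ‖s‖ := by gcongr
        _ = _ := by ring) (Set.right_mem_Icc.2 zero_le_one)
  simpa using key

lemma gradient_regCoarseModel {n nc : ℕ} {phi : Vec nc → ℝ} (hd : Differentiable ℝ phi)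
    (R : Vec n →L[ℝ] Vec nc) (g x : Vec n) (lam : ℝ) (s : Vec nc) :
    gradient (regCoarseModel phi R g x lam) s =
      gradient phi (R x + s) + (R g - gradient phi (R x)) + (lam * ‖g‖) • s := by
  apply HasGradientAt.gradient
  rw [hasGradientAt_iff_hasFDerivAt]
  have h1 : HasFDerivAt (fun s => phi (R x + s)) (fderiv ℝ phi (R x + s)) s :=
    (hd (R x + s)).hasFDerivAt.comp s ((hasFDerivAt_id s).const_add (R x))
  have h2 : HasFDerivAt (fun s => ⟪R g - gradient phi (R x), s⟫)
      (innerSL ℝ (R g - gradient phi (R x))) s :=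
    (innerSL ℝ (R g - gradient phi (R x))).hasFDerivAt
  have h3 := ((hasStrictFDerivAt_norm_sq s).hasFDerivAt.const_mul (lam * ‖g‖ / 2))
  refine ((h1.add h2).add h3).congr_fderiv ?_
  ext v
  simp only [add_apply, smul_apply, innerSL_apply_apply,
    InnerProductSpace.toDual_apply_apply, inner_add_left, real_inner_smul_left,
    ← inner_gradient_eq_fderiv, smul_eq_mul, nsmul_eq_mul, Nat.cast_ofNat]
  ring

/-! ### Constants of the analysis -/

namespace Constants

variable (c : Constants)

/-- `‖s*‖ ≤ coarseBound / λ` for every coarse step which can be accepted. -/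
def coarseBound : ℝ := 2 * c.kappaR * (c.Lphi + c.theta) / c.theta

/-- `‖s‖ ≤ stepBound / λ` for every trial step which can be accepted. -/
def stepBound : ℝ := 1 + c.kappaR * c.coarseBound

/-- If the model gradient is accurate, then predicted and actual reduction differ by at most
`modelError / λ ^ 2`. -/
def modelError : ℝ :=
  c.Lphi / 2 * c.coarseBound ^ 2 + c.kappag * c.stepBound + c.Lf / 2 * c.stepBound ^ 2

/-- Threshold on `λ * ‖∇f(x)‖`, from which on an iteration with accurate gradient and estimates is
successful. -/
def zeta : ℝ :=
  1 + 2 * c.kappag + c.eta2 +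
    16 * (c.modelError + 2 * c.epsf) / ((1 - c.eta1) * c.kappaH ^ 2)

/-- Coefficient of the decrease of the objective in a successful iteration. -/
def decrease : ℝ := c.eta1 * c.kappaH ^ 2 / 16 * min 1 c.eta2

/-- Weight of `λ⁻²` in the potential function. -/
def tau : ℝ := c.gamma ^ 2 * c.decrease / 2

/-- Coefficient of the guaranteed decrease of the potential when the estimates are accurate. -/
def sigma : ℝ := c.tau * (1 - c.gamma ^ 2)

/-- Coefficient of the worst possible increase of the potential. -/
def growth : ℝ := c.stepBound + c.Lf / 2 * c.stepBound ^ 2 + c.decrease / 2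

variable {c}

lemma Admissible.coarseBound_nonneg (hc : c.Admissible) : 0 ≤ c.coarseBound := by
  have := hc.kappaR_pos; have := hc.theta_pos
  unfold coarseBound; positivity

lemma Admissible.one_le_stepBound (hc : c.Admissible) : 1 ≤ c.stepBound := by
  have := hc.kappaR_pos; have := hc.coarseBound_nonneg
  unfold stepBound
  nlinarith [mul_nonneg hc.kappaR_pos.le hc.coarseBound_nonneg]

lemma Admissible.modelError_nonneg (hc : c.Admissible) : 0 ≤ c.modelError := by
  have := hc.kappag_nonneg; have := hc.one_le_stepBound
  unfold modelError; positivity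

lemma Admissible.zeta_term_nonneg (hc : c.Admissible) :
    0 ≤ 16 * (c.modelError + 2 * c.epsf) / ((1 - c.eta1) * c.kappaH ^ 2) := by
  have := hc.modelError_nonneg; have := hc.epsf_pos; have := hc.kappaH_pos
  have := sub_pos.2 hc.eta1_lt_one
  positivity

lemma Admissible.one_le_zeta (hc : c.Admissible) : 1 ≤ c.zeta := by
  have := hc.zeta_term_nonneg; have := hc.kappag_nonneg; have := hc.eta2_pos
  unfold zeta; linarith

lemma Admissible.decrease_pos (hc : c.Admissible) : 0 < c.decrease := by
  have := hc.eta1_pos; have := hc.kappaH_pos; have := hc.eta2_pos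
  unfold decrease; positivity

lemma Admissible.tau_pos (hc : c.Admissible) : 0 < c.tau := by
  have := hc.gamma_pos; have := hc.decrease_pos
  unfold tau; positivity

lemma Admissible.sigma_pos (hc : c.Admissible) : 0 < c.sigma := by
  have h1 := hc.tau_pos; have h2 := hc.gamma_pos; have h3 := hc.gamma_lt_one
  unfold sigma
  have : 0 < 1 - c.gamma ^ 2 := by nlinarith
  positivity

lemma Admissible.growth_pos (hc : c.Admissible) : 0 < c.growth := by
  have := hc.one_le_stepBound; have := hc.decrease_pos
  unfold growth; positivity

lemma Admissible.Lphi_add_theta_le (hc : c.Admissible) : (c.Lphi : ℝ) + c.theta ≤ c.eta2 :=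
  (le_max_left _ _).trans hc.eta2_ge

end Constants

/-- The potential function `f(x) + τ / λ ^ 2` of the convergence analysis. -/
def potential {n : ℕ} (c : Constants) (f : Vec n → ℝ) (xl : Vec n × ℝ) : ℝ :=
  f xl.1 + c.tau / xl.2 ^ 2

/-! ### Quality of an acceptable trial step -/

namespace IterData

variable {n nc : ℕ}

/-- The deterministic requirements on the data of one iteration performed at `(x, lam)`. -/
structure Regular (d : IterData n nc) (c : Constants) (x : Vec n) (lam : ℝ) : Prop where
  norm_R_le : ‖d.R‖ ≤ c.kappaR
  coarse_valid : d.coarse = true → d.CoarseStepValid c x lam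
  contDiff_phi : ContDiff ℝ 1 d.phi
  lipschitz_phi : LipschitzWith c.Lphi (gradient d.phi)

variable {d : IterData n nc} {c : Constants} {x : Vec n} {lam : ℝ}

lemma coarseModel_zero_sub (d : IterData n nc) (x : Vec n) (s : Vec nc) :
    coarseModel d.phi d.R d.g x 0 - coarseModel d.phi d.R d.g x s =
      -(d.phi (d.R x + s) - d.phi (d.R x) - ⟪gradient d.phi (d.R x), s⟫) - ⟪d.R d.g, s⟫ := by
  simp only [coarseModel, inner_sub_left, inner_zero_right, add_zero]
  ring

/-- The descent condition on the regularized coarse model and the quadratic upper bound on the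
first-order remainder confine the coarse step to a ball of radius `O(1 / λ)`. -/
lemma Regular.norm_sStar_le (hc : c.Admissible) (hd : d.Regular c x lam) (hlam : 0 < lam)
    (hcoarse : d.coarse = true) (hg : c.eta2 / lam ≤ ‖d.g‖) :
    ‖d.sStar‖ ≤ c.coarseBound / lam := by
  obtain ⟨-, hdec, -⟩ := hd.coarse_valid hcoarse
  have h2 := abs_sub_sub_inner_gradient_le (hd.contDiff_phi.differentiable one_ne_zero)
    hd.lipschitz_phi (d.R x) d.sStar
  have h3 := coarseModel_zero_sub d x d.sStar
  have hgpos : 0 < ‖d.g‖ := (div_pos hc.eta2_pos hlam).trans_le hg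
  have hin : -⟪d.R d.g, d.sStar⟫ ≤ c.kappaR * ‖d.g‖ * ‖d.sStar‖ := by
    refine (neg_le_abs _).trans ((abs_real_inner_le_norm _ _).trans ?_)
    gcongr
    exact (d.R.le_opNorm _).trans (by gcongr; exact hd.norm_R_le)
  simp only [regCoarseModel, norm_zero] at hdec
  have h4 := neg_abs_le (d.phi (d.R x + d.sStar) - d.phi (d.R x) -
    ⟪gradient d.phi (d.R x), d.sStar⟫)
  have hlg : c.eta2 ≤ lam * ‖d.g‖ := by rwa [div_le_iff₀' hlam] at hg
  have hθ := hc.theta_pos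
  have hLθ : 0 < (c.Lphi : ℝ) + c.theta := by positivity
  rcases (norm_nonneg d.sStar).eq_or_lt with h0 | hs
  · rw [← h0]; exact div_nonneg hc.coarseBound_nonneg hlam.le
  -- divide the descent condition by `‖s*‖`
  have h5 : (lam * ‖d.g‖ - c.Lphi) * ‖d.sStar‖ ≤ 2 * c.kappaR * ‖d.g‖ := by
    refine le_of_mul_le_mul_right ?_ hs
    nlinarith
  -- as `Lφ + θ ≤ η₂ ≤ λ ‖g‖`, subtracting `Lφ` costs at most a fixed factor
  have h6 : lam * ‖d.g‖ * c.theta ≤ (c.Lphi + c.theta) * (lam * ‖d.g‖ - c.Lphi) := by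
    nlinarith [hc.Lphi_add_theta_le, c.Lphi.coe_nonneg]
  have h7 : lam * c.theta * ‖d.sStar‖ ≤ 2 * c.kappaR * (c.Lphi + c.theta) := by
    refine le_of_mul_le_mul_left ?_ hgpos
    nlinarith [mul_le_mul_of_nonneg_right h6 hs.le, mul_le_mul_of_nonneg_left h5 hLθ.le]
  rw [Constants.coarseBound, div_div, le_div_iff₀ (by positivity)]
  linarith

/-- Approximate stationarity together with `κ_H ‖g‖ ≤ ‖R g‖` bounds the coarse step away
from zero. -/
lemma Regular.le_norm_sStar (hc : c.Admissible) (hd : d.Regular c x lam) (hlam : 0 < lam)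
    (hcoarse : d.coarse = true) (hg : c.eta2 / lam ≤ ‖d.g‖) :
    c.kappaH / (2 * lam) ≤ ‖d.sStar‖ := by
  obtain ⟨hH, -, hst⟩ := hd.coarse_valid hcoarse
  rw [gradient_regCoarseModel (hd.contDiff_phi.differentiable one_ne_zero)] at hst
  have hgpos : 0 < ‖d.g‖ := (div_pos hc.eta2_pos hlam).trans_le hg
  have hlg : c.eta2 ≤ lam * ‖d.g‖ := by rwa [div_le_iff₀' hlam] at hg
  have h1 := hd.lipschitz_phi.norm_sub_le (d.R x + d.sStar) (d.R x)
  rw [add_sub_cancel_left] at h1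
  set G := gradient d.phi (d.R x + d.sStar) + (d.R d.g - gradient d.phi (d.R x)) +
    (lam * ‖d.g‖) • d.sStar with hG
  have h2 : d.R d.g = G - (gradient d.phi (d.R x + d.sStar) - gradient d.phi (d.R x)) -
      (lam * ‖d.g‖) • d.sStar := by rw [hG]; abel
  have h3 : ‖d.R d.g‖ ≤ c.theta * ‖d.sStar‖ + c.Lphi * ‖d.sStar‖ +
      lam * ‖d.g‖ * ‖d.sStar‖ := by
    rw [h2]
    refine (norm_sub_le _ _).trans (add_le_add ((norm_sub_le _ _).trans (add_le_add hst h1)) ?_)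
    rw [norm_smul, Real.norm_of_nonneg (by positivity)]
  have h4 := hc.Lphi_add_theta_le
  rw [div_le_iff₀ (by positivity)]
  refine le_of_mul_le_mul_right ?_ hgpos
  nlinarith [norm_nonneg d.sStar]

lemma Regular.norm_step_le (hc : c.Admissible) (hd : d.Regular c x lam) (hlam : 0 < lam)
    (hg : c.eta2 / lam ≤ ‖d.g‖) : ‖d.step lam‖ ≤ c.stepBound / lam := by
  have hgpos : 0 < ‖d.g‖ := (div_pos hc.eta2_pos hlam).trans_le hg
  have hR := hc.kappaR_pos
  have hcb := hc.coarseBound_nonneg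
  by_cases h : d.coarse = true
  · have hs := hd.norm_sStar_le hc hlam h hg
    simp only [step, h, if_true]
    refine (ContinuousLinearMap.le_opNorm _ _).trans ?_
    rw [LinearIsometryEquiv.norm_map]
    calc ‖d.R‖ * ‖d.sStar‖ ≤ c.kappaR * (c.coarseBound / lam) := by
          gcongr; exact hd.norm_R_le
      _ = c.kappaR * c.coarseBound / lam := by ring
      _ ≤ _ := by gcongr; simp [Constants.stepBound]
  · simp only [step, h]
    rw [if_neg (by simp), norm_neg, norm_smul, Real.norm_of_nonneg (by positivity)]
    calc 1 / (lam * ‖d.g‖) * ‖d.g‖ = 1 / lam := by field_simp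
      _ ≤ _ := by gcongr; exact hc.one_le_stepBound

lemma predictedReduction_of_fine (h : ¬ d.coarse = true) (hlam : 0 < lam) (hg : 0 < ‖d.g‖) :
    d.predictedReduction x lam = ‖d.g‖ / lam ∧
      d.predictedReduction x lam = -⟪d.g, d.step lam⟫ := by
  have h1 : d.predictedReduction x lam = -⟪d.g, d.step lam⟫ := by
    simp [predictedReduction, h, fineModel]
  refine ⟨?_, h1⟩
  rw [h1]
  simp only [step, h]
  rw [if_neg (by simp), inner_neg_right, real_inner_smul_right, real_inner_self_eq_norm_sq]
  field_simp

/-- The predicted reduction is at least a fixed multiple of `‖g‖ / λ`. -/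
lemma Regular.le_predictedReduction (hc : c.Admissible) (hd : d.Regular c x lam) (hlam : 0 < lam)
    (hg : c.eta2 / lam ≤ ‖d.g‖) :
    c.kappaH ^ 2 / 8 * (‖d.g‖ / lam) ≤ d.predictedReduction x lam := by
  have hgpos : 0 < ‖d.g‖ := (div_pos hc.eta2_pos hlam).trans_le hg
  have hκ := hc.kappaH_pos
  by_cases h : d.coarse = true
  · have hs := hd.le_norm_sStar hc hlam h hg
    obtain ⟨-, hdec, -⟩ := hd.coarse_valid h
    simp only [regCoarseModel, norm_zero] at hdec
    simp only [predictedReduction, h, if_true]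
    have : (c.kappaH / (2 * lam)) ^ 2 ≤ ‖d.sStar‖ ^ 2 := by gcongr
    calc c.kappaH ^ 2 / 8 * (‖d.g‖ / lam)
        = lam * ‖d.g‖ / 2 * (c.kappaH / (2 * lam)) ^ 2 := by field_simp; ring
      _ ≤ lam * ‖d.g‖ / 2 * ‖d.sStar‖ ^ 2 := by gcongr
      _ ≤ _ := by linarith
  · rw [(predictedReduction_of_fine h hlam hgpos).1]
    have : c.kappaH ^ 2 / 8 ≤ 1 := by nlinarith [hc.kappaH_lt_one]
    exact mul_le_of_le_one_left (by positivity) this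

/-- The correction term makes the coarse model first-order coherent with the fine one: the
predicted reduction is `-gᵀ s` up to `O(1 / λ ^ 2)`. -/
lemma Regular.abs_predictedReduction_add_inner_le (hc : c.Admissible) (hd : d.Regular c x lam)
    (hlam : 0 < lam) (hg : c.eta2 / lam ≤ ‖d.g‖) :
    |d.predictedReduction x lam + ⟪d.g, d.step lam⟫| ≤
      c.Lphi / 2 * c.coarseBound ^ 2 / lam ^ 2 := by
  have hgpos : 0 < ‖d.g‖ := (div_pos hc.eta2_pos hlam).trans_le hg
  by_cases h : d.coarse = true
  · simp only [predictedReduction, step, h, if_true]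
    rw [coarseModel_zero_sub, ContinuousLinearMap.adjoint_inner_right, sub_add_cancel, abs_neg]
    refine (abs_sub_sub_inner_gradient_le (hd.contDiff_phi.differentiable one_ne_zero)
      hd.lipschitz_phi (d.R x) d.sStar).trans ?_
    calc (c.Lphi : ℝ) / 2 * ‖d.sStar‖ ^ 2 ≤ c.Lphi / 2 * (c.coarseBound / lam) ^ 2 := by
          gcongr; exact hd.norm_sStar_le hc hlam h hg
      _ = _ := by ring
  · rw [(predictedReduction_of_fine h hlam hgpos).2, neg_add_cancel, abs_zero]
    positivity

/-! ### One-iteration estimates for the potential function -/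

variable {f : Vec n → ℝ}

lemma next_of_successful (h : d.Successful c x lam) :
    d.next c (x, lam) = (x + d.step lam, c.gamma * lam) := if_pos h

lemma next_of_not_successful (h : ¬ d.Successful c x lam) :
    d.next c (x, lam) = (x, c.gamma⁻¹ * lam) := if_neg h

lemma potential_next_of_successful (hc : c.Admissible) (hlam : 0 < lam)
    (h : d.Successful c x lam) :
    potential c f (d.next c (x, lam)) - potential c f (x, lam) =
      f (x + d.step lam) - f x + (c.decrease / 2 - c.tau) * (1 / lam ^ 2) := by
  have := hc.gamma_pos
  rw [next_of_successful h]
  simp only [potential, Constants.tau]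
  field_simp
  ring

lemma potential_next_of_not_successful (hc : c.Admissible) (hlam : 0 < lam)
    (h : ¬ d.Successful c x lam) :
    potential c f (d.next c (x, lam)) - potential c f (x, lam) = -c.sigma * (1 / lam ^ 2) := by
  have := hc.gamma_pos
  rw [next_of_not_successful h]
  simp only [potential, Constants.sigma]
  field_simp
  ring

/-- With accurate estimates, an iteration never increases the potential, whether or not the model
is accurate: the acceptance test forces a decrease of the objective which dominates the
estimation error. -/
lemma Regular.potential_next_le_of_accurate (hc : c.Admissible) (hd : d.Regular c x lam)
    (hlam : 0 < lam) (hJ : AccurateEstimates c.epsf f x (d.step lam) lam d.fk d.fks) :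
    potential c f (d.next c (x, lam)) - potential c f (x, lam) ≤ -c.sigma * (1 / lam ^ 2) := by
  by_cases h : d.Successful c x lam
  · rw [potential_next_of_successful hc hlam h]
    obtain ⟨hρ, hg⟩ := h
    have hκ := hc.kappaH_pos
    have hη1 := hc.eta1_pos
    have hη2 := hc.eta2_pos
    have hp := hd.le_predictedReduction hc hlam hg
    have hgpos : 0 < ‖d.g‖ := (div_pos hc.eta2_pos hlam).trans_le hg
    have hppos : 0 < d.predictedReduction x lam := lt_of_lt_of_le (by positivity) hp
    rw [rho, le_div_iff₀ hppos] at hρ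
    have h1 : c.kappaH ^ 2 / 8 * (c.eta2 * (1 / lam ^ 2)) ≤ d.predictedReduction x lam := by
      refine le_trans ?_ hp
      calc _ = c.kappaH ^ 2 / 8 * (c.eta2 / lam / lam) := by field_simp
        _ ≤ _ := by gcongr
    have h2 := abs_le.1 hJ.1
    have h3 := abs_le.1 hJ.2
    have he : c.epsf ≤ c.eta1 * c.eta2 * c.kappaH ^ 2 / 32 := hc.epsf_le.trans (min_le_right _ _)
    have hδ : 0 ≤ 1 / lam ^ 2 := by positivity
    have he' : c.epsf / lam ^ 2 ≤ c.eta1 * c.eta2 * c.kappaH ^ 2 / 32 * (1 / lam ^ 2) := by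
      rw [div_eq_mul_one_div]; gcongr
    have h4 := mul_le_mul_of_nonneg_left h1 hη1.le
    have h5 : c.decrease ≤ c.eta1 * c.kappaH ^ 2 / 16 * c.eta2 := by
      unfold Constants.decrease; gcongr; exact min_le_right _ _
    have h6 := mul_le_mul_of_nonneg_right h5 hδ
    have h7 := mul_nonneg hc.decrease_pos.le hδ
    have h8 : c.sigma ≤ c.tau := by
      unfold Constants.sigma; nlinarith [hc.tau_pos, sq_nonneg c.gamma]
    have h9 := mul_le_mul_of_nonneg_right h8 hδ
    nlinarith
  · exact (potential_next_of_not_successful hc hlam h).le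

/-- Whatever the accuracy, the length of an accepted step is `O(1 / λ)`, which limits the increase
of the potential. -/
lemma Regular.potential_next_le (hc : c.Admissible) (hd : d.Regular c x lam)
    (hf : Differentiable ℝ f) (hL : LipschitzWith c.Lf (gradient f)) (hlam : 0 < lam) :
    potential c f (d.next c (x, lam)) - potential c f (x, lam) ≤
      c.stepBound * (‖gradient f x‖ * (1 / lam)) +
        (c.Lf / 2 * c.stepBound ^ 2 + c.decrease / 2) * (1 / lam ^ 2) := by
  have hK : 0 ≤ c.stepBound := zero_le_one.trans hc.one_le_stepBound
  have hδ : 0 ≤ 1 / lam ^ 2 := by positivity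
  by_cases h : d.Successful c x lam
  · rw [potential_next_of_successful hc hlam h]
    have hs := hd.norm_step_le hc hlam h.2
    have h1 := (abs_le.1 (abs_sub_sub_inner_gradient_le hf hL x (d.step lam))).2
    have h2 : ⟪gradient f x, d.step lam⟫ ≤ c.stepBound * (‖gradient f x‖ * (1 / lam)) := by
      refine (real_inner_le_norm _ _).trans ?_
      calc _ ≤ ‖gradient f x‖ * (c.stepBound / lam) := by gcongr
        _ = _ := by ring
    have h3 : c.Lf / 2 * ‖d.step lam‖ ^ 2 ≤ c.Lf / 2 * c.stepBound ^ 2 * (1 / lam ^ 2) := by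
      calc _ ≤ c.Lf / 2 * (c.stepBound / lam) ^ 2 := by gcongr
        _ = _ := by ring
    have h4 := mul_nonneg hc.tau_pos.le hδ
    linarith
  · rw [potential_next_of_not_successful hc hlam h]
    have h1 := mul_nonneg hc.sigma_pos.le hδ
    have h2 := hc.decrease_pos
    have h3 : 0 ≤ c.stepBound * (‖gradient f x‖ * (1 / lam)) +
        (c.Lf / 2 * c.stepBound ^ 2 + c.decrease / 2) * (1 / lam ^ 2) := by positivity
    linarith

/-- If `‖∇f(x)‖` is large compared to `1 / λ`, then accurate gradient and estimates make the
iteration successful, with a decrease of the potential proportional to `‖∇f(x)‖ / λ`. -/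
lemma Regular.successful_and_potential_next_le (hc : c.Admissible) (hd : d.Regular c x lam)
    (hf : Differentiable ℝ f) (hL : LipschitzWith c.Lf (gradient f)) (hlam : 0 < lam)
    (hI : ‖gradient f x - d.g‖ ≤ c.kappag / lam)
    (hJ : AccurateEstimates c.epsf f x (d.step lam) lam d.fk d.fks)
    (hbig : c.zeta * (1 / lam) ≤ ‖gradient f x‖) :
    d.Successful c x lam ∧
      potential c f (d.next c (x, lam)) - potential c f (x, lam) ≤
        -(c.decrease / 2) * (‖gradient f x‖ * (1 / lam)) := by
  have hκ := hc.kappaH_pos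
  have hη1 := hc.eta1_pos
  have hη1' := sub_pos.2 hc.eta1_lt_one
  have hη2 := hc.eta2_pos
  have hκg := hc.kappag_nonneg
  have hK : 0 ≤ c.stepBound := zero_le_one.trans hc.one_le_stepBound
  have hz := hc.zeta_term_nonneg
  have hM := hc.modelError_nonneg
  have he := hc.epsf_pos
  have hδ : 0 < 1 / lam := by positivity
  have hδ2 : 1 / lam ^ 2 = (1 / lam) * (1 / lam) := by field_simp
  have hng : ‖gradient f x‖ - c.kappag / lam ≤ ‖d.g‖ := by
    have := norm_sub_norm_le (gradient f x) d.g
    linarith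
  have hδκ : c.kappag / lam = c.kappag * (1 / lam) := by ring
  have hzeta : (1 + 2 * c.kappag + c.eta2) * (1 / lam) ≤ ‖gradient f x‖ := by
    refine le_trans ?_ hbig
    gcongr
    unfold Constants.zeta; linarith
  have hκδ : 0 ≤ c.kappag * (1 / lam) := by positivity
  have hηδ : 0 ≤ c.eta2 * (1 / lam) := by positivity
  have hg : c.eta2 / lam ≤ ‖d.g‖ := by rw [div_eq_mul_one_div]; linarith
  have hg2 : ‖gradient f x‖ / 2 ≤ ‖d.g‖ := by linarith
  have hp := hd.le_predictedReduction hc hlam hg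
  have hp' : c.kappaH ^ 2 / 16 * (‖gradient f x‖ * (1 / lam)) ≤ d.predictedReduction x lam := by
    refine le_trans ?_ hp
    calc _ = c.kappaH ^ 2 / 8 * ((‖gradient f x‖ / 2) / lam) := by ring
      _ ≤ _ := by gcongr
  have hppos : 0 < d.predictedReduction x lam := by
    have : 0 < ‖d.g‖ := (div_pos hc.eta2_pos hlam).trans_le hg
    exact lt_of_lt_of_le (by positivity) hp
  -- the actual reduction agrees with the predicted one up to `modelError / lam ^ 2`
  have hs := hd.norm_step_le hc hlam hg
  have hact : d.predictedReduction x lam - c.modelError * (1 / lam ^ 2) ≤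
      f x - f (x + d.step lam) := by
    have h1 := (abs_le.1 (abs_sub_sub_inner_gradient_le hf hL x (d.step lam))).2
    have h2 := (abs_le.1 (hd.abs_predictedReduction_add_inner_le hc hlam hg)).2
    have h3 : ⟪gradient f x - d.g, d.step lam⟫ ≤ c.kappag * c.stepBound * (1 / lam ^ 2) := by
      refine (real_inner_le_norm _ _).trans ?_
      calc _ ≤ (c.kappag / lam) * (c.stepBound / lam) := by gcongr
        _ = _ := by ring
    rw [inner_sub_left] at h3
    have h4 : c.Lf / 2 * ‖d.step lam‖ ^ 2 ≤ c.Lf / 2 * c.stepBound ^ 2 * (1 / lam ^ 2) := by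
      calc _ ≤ c.Lf / 2 * (c.stepBound / lam) ^ 2 := by gcongr
        _ = _ := by ring
    have h5 : c.modelError * (1 / lam ^ 2) = c.Lphi / 2 * c.coarseBound ^ 2 / lam ^ 2 +
        c.kappag * c.stepBound * (1 / lam ^ 2) +
        c.Lf / 2 * c.stepBound ^ 2 * (1 / lam ^ 2) := by
      unfold Constants.modelError; ring
    linarith
  -- the errors are absorbed by the choice of `zeta`
  have habs : (c.modelError + 2 * c.epsf) * (1 / lam ^ 2) ≤
      (1 - c.eta1) * d.predictedReduction x lam := by
    have h1 : 16 * (c.modelError + 2 * c.epsf) / ((1 - c.eta1) * c.kappaH ^ 2) * (1 / lam) ≤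
        ‖gradient f x‖ := by
      refine le_trans ?_ hbig
      gcongr
      unfold Constants.zeta; linarith
    calc (c.modelError + 2 * c.epsf) * (1 / lam ^ 2)
        = (1 - c.eta1) * (c.kappaH ^ 2 / 16 *
          (16 * (c.modelError + 2 * c.epsf) / ((1 - c.eta1) * c.kappaH ^ 2) * (1 / lam) *
            (1 / lam))) := by
          field_simp
      _ ≤ (1 - c.eta1) * (c.kappaH ^ 2 / 16 * (‖gradient f x‖ * (1 / lam))) := by gcongr
      _ ≤ _ := by gcongr
  have h2 := abs_le.1 hJ.1
  have h3 := abs_le.1 hJ.2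
  have he' : c.epsf / lam ^ 2 = c.epsf * (1 / lam ^ 2) := by ring
  have hsucc : d.Successful c x lam := by
    refine ⟨?_, hg⟩
    rw [rho, le_div_iff₀ hppos]
    linarith
  refine ⟨hsucc, ?_⟩
  rw [potential_next_of_successful hc hlam hsucc]
  have hlδ2 : 0 ≤ 1 / lam ^ 2 := by positivity
  have h4 := mul_nonneg he.le hlδ2
  have h5 : c.decrease * (‖gradient f x‖ * (1 / lam)) ≤ c.eta1 * d.predictedReduction x lam := by
    calc _ ≤ c.eta1 * c.kappaH ^ 2 / 16 * (‖gradient f x‖ * (1 / lam)) := by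
          gcongr
          unfold Constants.decrease
          exact mul_le_of_le_one_right (by positivity) (min_le_left _ _)
      _ = c.eta1 * (c.kappaH ^ 2 / 16 * (‖gradient f x‖ * (1 / lam))) := by ring
      _ ≤ _ := by gcongr
  have h6 : 1 / lam ^ 2 ≤ ‖gradient f x‖ * (1 / lam) := by
    rw [hδ2]
    gcongr
    nlinarith
  have h7 := mul_le_mul_of_nonneg_left h6 hc.decrease_pos.le
  have h8 := mul_nonneg hc.tau_pos.le hlδ2
  linarith

end IterData

/-! ### Measurability of the iterates -/

section Measurability

variable {Ω : Type u} [MeasurableSpace Ω] {n nc : ℕ}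

/-- Evaluation of a random continuous function at a random point: measurability for the
`σ`-algebra of point evaluations suffices. -/
lemma measurable_apply_of_continuous {m : ℕ} {phi : Ω → Vec m → ℝ} {y : Ω → Vec m}
    (hphi : Measurable phi) (hcont : ∀ ω, Continuous (phi ω)) (hy : Measurable y) :
    Measurable fun ω => phi ω (y ω) := by
  have h := measurable_uncurry_of_continuous_of_measurable (u := fun (v : Vec m) ω => phi ω v)
    hcont (fun v => (measurable_pi_apply v).comp hphi)
  exact h.comp (hy.prodMk measurable_id)

/-- The directional derivative is measurable, being a limit of difference quotients. -/
lemma measurable_inner_gradient {m : ℕ} {phi : Ω → Vec m → ℝ} {y v : Ω → Vec m}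
    (hphi : Measurable phi) (hdiff : ∀ ω, Differentiable ℝ (phi ω)) (hy : Measurable y)
    (hv : Measurable v) : Measurable fun ω => ⟪gradient (phi ω) (y ω), v ω⟫ := by
  have hcont := fun ω => (hdiff ω).continuous
  refine measurable_of_tendsto_metrizable (f := fun (k : ℕ) ω =>
    (1 / ((k : ℝ) + 1))⁻¹ • (phi ω (y ω + (1 / ((k : ℝ) + 1)) • v ω) - phi ω (y ω)))
    (fun k => ?_) ?_
  · have hk := hy.add (hv.const_smul (1 / ((k : ℝ) + 1)))
    exact ((measurable_apply_of_continuous hphi hcont hk).sub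
      (measurable_apply_of_continuous hphi hcont hy)).const_smul (1 / ((k : ℝ) + 1))⁻¹
  · rw [tendsto_pi_nhds]
    intro ω
    rw [inner_gradient_eq_fderiv]
    have h1 : Tendsto (fun k : ℕ => 1 / ((k : ℝ) + 1)) atTop (𝓝[≠] 0) :=
      tendsto_nhdsWithin_iff.2 ⟨tendsto_one_div_add_atTop_nhds_zero_nat,
        Eventually.of_forall fun k => Nat.one_div_pos_of_nat.ne'⟩
    exact ((hdiff ω (y ω)).hasFDerivAt.hasLineDerivAt (v ω)).tendsto_slope_zero.comp h1

lemma measurable_clm_apply {m m' : ℕ} {R : Ω → Vec m →L[ℝ] Vec m'} {v : Ω → Vec m}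
    (hR : Measurable R) (hv : Measurable v) : Measurable fun ω => R ω (v ω) :=
  (isBoundedBilinearMap_apply (𝕜 := ℝ) (E := Vec m) (F := Vec m')).continuous.measurable.comp
    (hR.prodMk hv)

variable {d : Ω → IterData n nc}

lemma measurable_of_modelSigma_le (h : modelSigma d ≤ ‹MeasurableSpace Ω›) :
    Measurable (fun ω => (d ω).coarse) ∧ Measurable (fun ω => (d ω).R) ∧
      Measurable (fun ω => (d ω).g) ∧ Measurable (fun ω => (d ω).phi) ∧
      Measurable (fun ω => (d ω).sStar) := by
  simp only [modelSigma, sup_le_iff] at h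
  simp only [measurable_iff_comap_le]
  tauto

lemma measurable_of_estimateSigma_le (h : estimateSigma d ≤ ‹MeasurableSpace Ω›) :
    Measurable (fun ω => (d ω).fk) ∧ Measurable (fun ω => (d ω).fks) := by
  simp only [estimateSigma, sup_le_iff] at h
  simpa only [measurable_iff_comap_le] using h

variable {x : Ω → Vec n} {lam : Ω → ℝ}

lemma measurable_step (h : modelSigma d ≤ ‹MeasurableSpace Ω›) (hlam : Measurable lam) :
    Measurable fun ω => (d ω).step (lam ω) := by
  obtain ⟨h1, h2, h3, -, h5⟩ := measurable_of_modelSigma_le h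
  refine Measurable.ite (h1 (measurableSet_singleton true)) (measurable_clm_apply ?_ h5) ?_
  · exact (ContinuousLinearMap.adjoint
      (𝕜 := ℝ) (E := Vec n) (F := Vec nc)).continuous.measurable.comp h2
  · exact ((measurable_const.div (hlam.mul h3.norm)).smul h3).neg

lemma measurable_predictedReduction (h : modelSigma d ≤ ‹MeasurableSpace Ω›)
    (h' : estimateSigma d ≤ ‹MeasurableSpace Ω›) (hd : ∀ ω, ContDiff ℝ 1 (d ω).phi)
    (hx : Measurable x) (hlam : Measurable lam) :
    Measurable fun ω => (d ω).predictedReduction (x ω) (lam ω) := by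
  have hs := measurable_step h hlam
  obtain ⟨h1, h2, h3, h4, h5⟩ := measurable_of_modelSigma_le h
  obtain ⟨h6, -⟩ := measurable_of_estimateSigma_le h'
  have hcoarse : ∀ v : Ω → Vec nc, Measurable v →
      Measurable fun ω => coarseModel (d ω).phi (d ω).R (d ω).g (x ω) (v ω) := by
    intro v hv
    simp only [coarseModel, inner_sub_left]
    have hRx := measurable_clm_apply h2 hx
    exact (measurable_apply_of_continuous h4 (fun ω => (hd ω).continuous) (hRx.add hv)).add
      (((measurable_clm_apply h2 h3).inner hv).sub
        (measurable_inner_gradient h4 (fun ω => (hd ω).differentiable one_ne_zero) hRx hv))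
  have hfine : ∀ v : Ω → Vec n, Measurable v →
      Measurable fun ω => fineModel (d ω).fk (d ω).g (x ω) (v ω) :=
    fun v hv => h6.add (h3.inner (hv.sub hx))
  refine Measurable.ite (h1 (measurableSet_singleton true)) ?_ ?_
  · exact (hcoarse _ measurable_const).sub (hcoarse _ h5)
  · exact (hfine _ hx).sub (hfine _ (hx.add hs))

lemma measurable_next (c : Constants) (h : modelSigma d ≤ ‹MeasurableSpace Ω›)
    (h' : estimateSigma d ≤ ‹MeasurableSpace Ω›) (hd : ∀ ω, ContDiff ℝ 1 (d ω).phi)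
    (hx : Measurable x) (hlam : Measurable lam) :
    Measurable fun ω => (d ω).next c (x ω, lam ω) := by
  have hs := measurable_step h hlam
  have hp := measurable_predictedReduction h h' hd hx hlam
  obtain ⟨-, -, h3, -, -⟩ := measurable_of_modelSigma_le h
  obtain ⟨h6, h7⟩ := measurable_of_estimateSigma_le h'
  refine Measurable.ite (MeasurableSet.inter ?_ ?_)
    ((hx.add hs).prodMk (hlam.const_mul _)) (hx.prodMk (hlam.const_mul _))
  · exact measurableSet_le measurable_const ((h6.sub h7).div hp)
  · exact measurableSet_le (measurable_const.div hlam) h3.norm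

end Measurability

section Trajectory

variable {Ω : Type u} {n nc : ℕ} {c : Constants} {x0 : Vec n} {lam0 : ℝ}
  {D : ℕ → Ω → IterData n nc}

lemma past_mono (D : ℕ → Ω → IterData n nc) : Monotone (past D) := fun _ j hij =>
  iSup_le fun k => le_iSup (fun l : Fin j => modelSigma (D l) ⊔ estimateSigma (D l))
    ⟨k, k.2.trans_le hij⟩

lemma le_past_succ (D : ℕ → Ω → IterData n nc) (k : ℕ) :
    modelSigma (D k) ⊔ estimateSigma (D k) ≤ past D (k + 1) :=
  le_iSup (fun l : Fin (k + 1) => modelSigma (D l) ⊔ estimateSigma (D l)) ⟨k, k.lt_succ_self⟩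

lemma modelSigma_le_past_succ (D : ℕ → Ω → IterData n nc) (k : ℕ) :
    modelSigma (D k) ≤ past D (k + 1) := le_sup_left.trans (le_past_succ D k)

lemma estimateSigma_le_past_succ (D : ℕ → Ω → IterData n nc) (k : ℕ) :
    estimateSigma (D k) ≤ past D (k + 1) := le_sup_right.trans (le_past_succ D k)

lemma measurable_state (hphi : ∀ k ω, ContDiff ℝ 1 (D k ω).phi) (k : ℕ) :
    Measurable[past D k] (state c x0 lam0 D k) := by
  induction k with
  | zero => exact measurable_const
  | succ k ih =>
    have h := ih.mono (past_mono D k.le_succ) le_rfl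
    exact @measurable_next Ω (past D (k + 1)) n nc (D k) _ _ c (modelSigma_le_past_succ D k)
      (estimateSigma_le_past_succ D k) (hphi k) (measurable_fst.comp h) (measurable_snd.comp h)

lemma measurable_X (hphi : ∀ k ω, ContDiff ℝ 1 (D k ω).phi) (k : ℕ) :
    Measurable[past D k] (X c x0 lam0 D k) := measurable_fst.comp (measurable_state hphi k)

lemma measurable_Lam (hphi : ∀ k ω, ContDiff ℝ 1 (D k ω).phi) (k : ℕ) :
    Measurable[past D k] (Lam c x0 lam0 D k) := measurable_snd.comp (measurable_state hphi k)

lemma past_le [mΩ : MeasurableSpace Ω] (h : ∀ k, modelSigma (D k) ≤ mΩ)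
    (h' : ∀ k, estimateSigma (D k) ≤ mΩ) (k : ℕ) : past D k ≤ mΩ :=
  iSup_le fun j => sup_le (h j) (h' j)

/-! ### Deterministic properties of the trajectories -/

lemma Lam_succ (k : ℕ) (ω : Ω) :
    Lam c x0 lam0 D (k + 1) ω = c.gamma * Lam c x0 lam0 D k ω ∨
      Lam c x0 lam0 D (k + 1) ω = c.gamma⁻¹ * Lam c x0 lam0 D k ω := by
  simp only [Lam, state, IterData.next]
  split_ifs <;> simp

lemma Lam_pos (hc : c.Admissible) (hlam0 : 0 < lam0) (k : ℕ) (ω : Ω) :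
    0 < Lam c x0 lam0 D k ω := by
  induction k with
  | zero => exact hlam0
  | succ k ih =>
    have := hc.gamma_pos
    rcases Lam_succ (c := c) (x0 := x0) (lam0 := lam0) (D := D) k ω with h | h <;> rw [h] <;>
      positivity

lemma gamma_mul_Lam_le (hc : c.Admissible) (hlam0 : 0 < lam0) (k : ℕ) (ω : Ω) :
    c.gamma * Lam c x0 lam0 D k ω ≤ Lam c x0 lam0 D (k + 1) ω := by
  have h0 := Lam_pos (x0 := x0) (D := D) hc hlam0 k ω
  rcases Lam_succ (c := c) (x0 := x0) (lam0 := lam0) (D := D) k ω with h | h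
  · exact h.ge
  · rw [h]
    have := (one_le_inv₀ hc.gamma_pos).2 hc.gamma_lt_one.le
    have := hc.gamma_lt_one
    gcongr
    linarith

lemma Lam_succ_le (hc : c.Admissible) (hlam0 : 0 < lam0) (k : ℕ) (ω : Ω) :
    Lam c x0 lam0 D (k + 1) ω ≤ c.gamma⁻¹ * Lam c x0 lam0 D k ω := by
  have h0 := Lam_pos (x0 := x0) (D := D) hc hlam0 k ω
  rcases Lam_succ (c := c) (x0 := x0) (lam0 := lam0) (D := D) k ω with h | h
  · rw [h]
    have := (one_le_inv₀ hc.gamma_pos).2 hc.gamma_lt_one.le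
    have := hc.gamma_lt_one
    gcongr
    linarith
  · exact h.le

lemma gamma_pow_mul_le_Lam (hc : c.Admissible) (hlam0 : 0 < lam0) (k : ℕ) (ω : Ω) :
    c.gamma ^ k * lam0 ≤ Lam c x0 lam0 D k ω := by
  induction k with
  | zero => simp [Lam, state]
  | succ k ih =>
    have := hc.gamma_pos
    calc c.gamma ^ (k + 1) * lam0 = c.gamma * (c.gamma ^ k * lam0) := by ring
      _ ≤ c.gamma * Lam c x0 lam0 D k ω := by gcongr
      _ ≤ _ := gamma_mul_Lam_le hc hlam0 k ω

lemma regular {f : Vec n → ℝ} (hstep : StepAssumptions c x0 lam0 D)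
    (hsm : SmoothnessAssumptions c f D) (k : ℕ) (ω : Ω) :
    (D k ω).Regular c (X c x0 lam0 D k ω) (Lam c x0 lam0 D k ω) :=
  ⟨hstep.norm_R_le k ω, hstep.coarse_valid k ω, hsm.contDiff_phi k ω, hsm.lipschitz_phi k ω⟩

lemma norm_X_succ_sub_le {f : Vec n → ℝ} (hc : c.Admissible) (hlam0 : 0 < lam0)
    (hstep : StepAssumptions c x0 lam0 D) (hsm : SmoothnessAssumptions c f D) (k : ℕ) (ω : Ω) :
    ‖X c x0 lam0 D (k + 1) ω - X c x0 lam0 D k ω‖ ≤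
      c.stepBound * (1 / Lam c x0 lam0 D k ω) := by
  have h0 := Lam_pos (x0 := x0) (D := D) hc hlam0 k ω
  have hK : 0 ≤ c.stepBound := zero_le_one.trans hc.one_le_stepBound
  by_cases h : (D k ω).Successful c (X c x0 lam0 D k ω) (Lam c x0 lam0 D k ω)
  · have h1 : X c x0 lam0 D (k + 1) ω =
        X c x0 lam0 D k ω + (D k ω).step (Lam c x0 lam0 D k ω) :=
      congrArg Prod.fst (IterData.next_of_successful h)
    rw [h1, add_sub_cancel_left]
    exact ((regular hstep hsm k ω).norm_step_le hc h0 h.2).trans_eq (by ring)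
  · have h2 : state c x0 lam0 D (k + 1) ω =
        (X c x0 lam0 D k ω, c.gamma⁻¹ * Lam c x0 lam0 D k ω) :=
      IterData.next_of_not_successful h
    have h1 : X c x0 lam0 D (k + 1) ω = X c x0 lam0 D k ω := by
      have h3 := congrArg Prod.fst h2
      exact h3
    rw [h1, sub_self, norm_zero]
    positivity

/-- Each iterate ranges over a bounded set. -/
lemma exists_norm_X_le {f : Vec n → ℝ} (hc : c.Admissible) (hlam0 : 0 < lam0)
    (hstep : StepAssumptions c x0 lam0 D) (hsm : SmoothnessAssumptions c f D) (k : ℕ) :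
    ∃ M, ∀ ω, ‖X c x0 lam0 D k ω‖ ≤ M := by
  induction k with
  | zero => exact ⟨‖x0‖, fun _ => le_rfl⟩
  | succ k ih =>
    obtain ⟨M, hM⟩ := ih
    refine ⟨c.stepBound * (1 / (c.gamma ^ k * lam0)) + M, fun ω => ?_⟩
    have := hc.gamma_pos
    have hK : 0 ≤ c.stepBound := zero_le_one.trans hc.one_le_stepBound
    calc _ = ‖(X c x0 lam0 D (k + 1) ω - X c x0 lam0 D k ω) + X c x0 lam0 D k ω‖ := by simp
      _ ≤ c.stepBound * (1 / Lam c x0 lam0 D k ω) + M :=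
        (norm_add_le _ _).trans (add_le_add (norm_X_succ_sub_le hc hlam0 hstep hsm k ω) (hM ω))
      _ ≤ _ := by
        gcongr
        exact gamma_pow_mul_le_Lam hc hlam0 k ω

end Trajectory

/-! ### Conditional probabilities, random walks and nonnegative series -/

section Probability

variable {Ω : Type u} {m : MeasurableSpace Ω} [mΩ : MeasurableSpace Ω] {μ : Measure Ω}
  [IsProbabilityMeasure μ]

lemma integrable_indicator_one {A : Set Ω} (hA : MeasurableSet A) :
    Integrable (A.indicator fun _ => (1 : ℝ)) μ := (integrable_const 1).indicator hA

/-- Lower bounds on conditional probabilities pass to larger measurable events. The smaller event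
need not be assumed measurable: otherwise the conditional expectation would be zero. -/
lemma le_condExp_indicator_of_subset {A B : Set Ω} {p : ℝ} (hp : 0 < p) (hB : MeasurableSet B)
    (hAB : A ⊆ B) (h : ∀ᵐ ω ∂μ, p ≤ (μ⟦A | m⟧) ω) : ∀ᵐ ω ∂μ, p ≤ (μ⟦B | m⟧) ω := by
  by_cases hA : Integrable (A.indicator fun _ => (1 : ℝ)) μ
  · have hle : A.indicator (fun _ => (1 : ℝ)) ≤ᵐ[μ] B.indicator fun _ => (1 : ℝ) :=
      ae_of_all _ (Set.indicator_le_indicator_of_subset hAB fun _ => zero_le_one)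
    filter_upwards [h, condExp_mono (m := m) hA (integrable_indicator_one hB) hle] with ω h1 h2
    exact h1.trans h2
  · rw [condExp_of_not_integrable hA] at h
    obtain ⟨ω, hω⟩ := h.exists
    exact absurd hω (not_le.2 hp)

lemma le_condExp_of_le {m₁ m₂ : MeasurableSpace Ω} (h₁₂ : m₁ ≤ m₂) (h₂ : m₂ ≤ mΩ) {g : Ω → ℝ}
    {p : ℝ} (h : ∀ᵐ ω ∂μ, p ≤ (μ[g | m₂]) ω) : ∀ᵐ ω ∂μ, p ≤ (μ[g | m₁]) ω := by
  have h1 := condExp_mono (m := m₁) (integrable_const p) (integrable_condExp (m := m₂) (f := g)) h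
  rw [condExp_const (h₁₂.trans h₂)] at h1
  filter_upwards [h1, condExp_condExp_of_le (f := g) (μ := μ) h₁₂ h₂] with ω h2 h3
  rwa [h3] at h2

lemma le_condExp_indicator_inter (hm : m ≤ mΩ) {A B : Set Ω} {p q : ℝ} (hA : MeasurableSet A)
    (hB : MeasurableSet B) (h : ∀ᵐ ω ∂μ, p ≤ (μ⟦A | m⟧) ω) (h' : ∀ᵐ ω ∂μ, q ≤ (μ⟦B | m⟧) ω) :
    ∀ᵐ ω ∂μ, p + q - 1 ≤ (μ⟦A ∩ B | m⟧) ω := by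
  set a : Ω → ℝ := A.indicator fun _ => 1
  set b : Ω → ℝ := B.indicator fun _ => 1
  have ha : Integrable a μ := integrable_indicator_one hA
  have hb : Integrable b μ := integrable_indicator_one hB
  have hle : a + b - (fun _ => (1 : ℝ)) ≤ᵐ[μ] (A ∩ B).indicator fun _ => (1 : ℝ) := by
    refine ae_of_all _ fun ω => ?_
    by_cases h1 : ω ∈ A <;> by_cases h2 : ω ∈ B <;> simp [a, b, h1, h2]
  filter_upwards [h, h', condExp_mono (m := m) ((ha.add hb).sub (integrable_const 1))
    (integrable_indicator_one (hA.inter hB)) hle, condExp_sub (ha.add hb) (integrable_const 1) m,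
    condExp_add ha hb m] with ω h1 h2 h3 h4 h5
  rw [h4, Pi.sub_apply, h5, Pi.add_apply, condExp_const hm] at h3
  linarith

lemma le_integral_mul_indicator (hm : m ≤ mΩ) {A : Set Ω} {p M : ℝ} (hA : MeasurableSet A)
    {W : Ω → ℝ} (hW : Measurable[m] W) (hW0 : ∀ ω, 0 ≤ W ω) (hWM : ∀ ω, W ω ≤ M)
    (h : ∀ᵐ ω ∂μ, p ≤ (μ⟦A | m⟧) ω) :
    p * ∫ ω, W ω ∂μ ≤ ∫ ω, W ω * A.indicator (fun _ => (1 : ℝ)) ω ∂μ := by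
  have hb : ∀ᵐ ω ∂μ, ‖W ω‖ ≤ M := ae_of_all _ fun ω => by
    rw [Real.norm_of_nonneg (hW0 ω)]; exact hWM ω
  have hWi : Integrable W μ := Integrable.of_bound (hW.mono hm le_rfl).aestronglyMeasurable M hb
  have h1 := condExp_stronglyMeasurable_mul_of_bound hm hW.stronglyMeasurable
    (integrable_indicator_one (μ := μ) hA) M hb
  rw [← integral_const_mul]
  calc ∫ ω, p * W ω ∂μ ≤ ∫ ω, (μ[W * A.indicator (fun _ => (1 : ℝ)) | m]) ω ∂μ := by
        refine integral_mono_ae (hWi.const_mul p) integrable_condExp ?_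
        filter_upwards [h, h1] with ω h2 h3
        rw [h3, Pi.mul_apply, mul_comm]
        exact mul_le_mul_of_nonneg_left h2 (hW0 ω)
    _ = _ := integral_condExp hm

/-- A random walk with steps `±1` whose upward conditional probabilities are at least `1/2` is
almost surely unbounded above: a submartingale with bounded increments converges where it is
bounded above, but a sequence with steps `±1` does not converge. -/
lemma ae_not_bddAbove_walk (ℱ : Filtration ℕ mΩ) {A : ℕ → Set Ω}
    (hA : ∀ k, MeasurableSet[ℱ (k + 1)] (A k))
    (h : ∀ k, ∀ᵐ ω ∂μ, 1 / 2 ≤ (μ⟦A k | ℱ k⟧) ω) :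
    ∀ᵐ ω ∂μ, ¬ BddAbove (Set.range fun N =>
      ∑ k ∈ Finset.range N, (2 * (A k).indicator (fun _ => (1 : ℝ)) ω - 1)) := by
  set a : ℕ → Ω → ℝ := fun k => (A k).indicator fun _ => 1 with ha
  set w : ℕ → Ω → ℝ := fun N ω => ∑ k ∈ Finset.range N, (2 * a k ω - 1) with hw
  have hai : ∀ k, Integrable (a k) μ := fun k => integrable_indicator_one (ℱ.le _ _ (hA k))
  have hsucc : ∀ k ω, w (k + 1) ω - w k ω = 2 * a k ω - 1 := fun k ω => by
    simp only [hw, Finset.sum_range_succ]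
    ring
  have habs : ∀ k ω, |2 * a k ω - 1| = 1 := fun k ω => by
    by_cases h1 : ω ∈ A k <;> simp [ha, h1]
    norm_num
  have hsub : Submartingale w ℱ μ := by
    refine submartingale_of_condExp_sub_nonneg_nat (fun N => ?_) (fun N => ?_) fun k => ?_
    · refine Measurable.stronglyMeasurable ?_
      refine Finset.measurable_sum _ fun k hk => ?_
      have : Measurable[ℱ (k + 1)] (a k) := measurable_const.indicator (hA k)
      exact ((this.mono (ℱ.mono (Finset.mem_range.1 hk)) le_rfl).const_mul 2).sub_const 1
    · exact integrable_finsetSum _ fun k _ => ((hai k).const_mul 2).sub (integrable_const 1)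
    · have h1 : w (k + 1) - w k = (2 : ℝ) • a k - fun _ => (1 : ℝ) := by
        ext ω; simp [hsucc]
      rw [h1]
      filter_upwards [h k, condExp_sub ((hai k).smul (2 : ℝ)) (integrable_const (1 : ℝ)) (ℱ k),
        condExp_smul (μ := μ) (2 : ℝ) (a k) (ℱ k)] with ω h2 h3 h4
      rw [h3, Pi.sub_apply, h4, condExp_const (ℱ.le k), Pi.smul_apply, smul_eq_mul, Pi.zero_apply]
      linarith
  have hbd := hsub.bddAbove_iff_exists_tendsto (R := 1)
    (ae_of_all _ fun ω k => by rw [hsucc, habs]; simp)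
  filter_upwards [hbd] with ω hω hb
  obtain ⟨l, hl⟩ := hω.1 hb
  have h1 := ((tendsto_add_atTop_iff_nat 1).2 hl).sub hl
  simp only [hsucc, sub_self] at h1
  have h2 := h1.abs
  simp only [habs, abs_zero] at h2
  exact one_ne_zero (tendsto_nhds_unique tendsto_const_nhds h2)

end Probability

lemma ae_summable_of_sum_integral_le {Ω : Type u} [MeasurableSpace Ω] {μ : Measure Ω}
    {W : ℕ → Ω → ℝ} {C : ℝ} (hi : ∀ k, Integrable (W k) μ)
    (h0 : ∀ k ω, 0 ≤ W k ω) (h : ∀ N, ∑ k ∈ Finset.range N, ∫ ω, W k ω ∂μ ≤ C) :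
    ∀ᵐ ω ∂μ, Summable fun k => W k ω := by
  have hs : Summable fun k => ∫ ω, W k ω ∂μ :=
    summable_of_sum_range_le (fun k => integral_nonneg (h0 k)) h
  have hmeas : ∀ k, AEMeasurable (fun ω => ENNReal.ofReal (W k ω)) μ := fun k =>
    (hi k).aestronglyMeasurable.aemeasurable.ennreal_ofReal
  have hfin : ∫⁻ ω, ∑' k, ENNReal.ofReal (W k ω) ∂μ ≠ ⊤ := by
    rw [lintegral_tsum hmeas]
    simp_rw [← ofReal_integral_eq_lintegral_ofReal (hi _) (ae_of_all _ (h0 _))]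
    exact hs.tsum_ofReal_ne_top
  filter_upwards [ae_lt_top' (AEMeasurable.tsum hmeas) hfin] with ω hω
  refine (ENNReal.summable_toReal hω.ne).congr fun k => ?_
  rw [ENNReal.toReal_ofReal (h0 k ω)]

/-! ### A deterministic convergence criterion -/

/-- Let consecutive terms of `h` differ by at most `δ k`, where `δ` does not shrink faster than
geometrically. If `δ` is summable over the indices where `h` exceeds any given level, and `h`
falls below any positive level infinitely often, then `h` tends to zero: for each `ε > 0` the
truncated sequence `max (h k) ε` has finite variation, hence converges, and its limit is `ε`. -/
lemma tendsto_zero_of_summable_indicator {h δ : ℕ → ℝ} {K : ℝ} (hh : ∀ k, 0 ≤ h k)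
    (hδ : ∀ k, 0 ≤ δ k) (hdiff : ∀ k, |h (k + 1) - h k| ≤ δ k) (hK : ∀ k, δ k ≤ K * δ (k + 1))
    (hsum : ∀ ε > 0, Summable fun k => if ε ≤ h k then δ k else 0)
    (hfreq : ∀ ε > 0, ∃ᶠ k in atTop, h k < ε) : Tendsto h atTop (𝓝 0) := by
  have key : ∀ ε > 0, Tendsto (fun k => max (h k) ε) atTop (𝓝 ε) := by
    intro ε hε
    set e : ℕ → ℝ := fun k => if ε ≤ h k then δ k else 0 with he
    have hs : Summable e := hsum ε hε
    have hs' : Summable fun k => e k + K * e (k + 1) :=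
      hs.add (((summable_nat_add_iff 1).2 hs).mul_left K)
    have hcauchy : CauchySeq fun k => max (h k) ε := by
      refine cauchySeq_of_dist_le_of_summable _ (fun k => ?_) hs'
      rw [dist_comm, Real.dist_eq]
      have h1 := abs_max_sub_max_le_abs (h (k + 1)) (h k) ε
      have h2 := hdiff k
      have h3 := hK k
      by_cases ha : ε ≤ h k <;> by_cases hb : ε ≤ h (k + 1) <;>
        simp only [he, ha, hb, if_true, if_false, mul_zero, add_zero, zero_add]
      · linarith [hδ k]
      · linarith
      · linarith
      · rw [max_eq_right (not_le.1 ha).le, max_eq_right (not_le.1 hb).le]; simp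
    obtain ⟨l, hl⟩ := cauchySeq_tendsto_of_complete hcauchy
    have hlε : l = ε := by
      by_contra hne
      have h1 : ∀ᶠ k in atTop, max (h k) ε ≠ ε := hl.eventually_ne hne
      obtain ⟨k, hk, hk'⟩ := ((hfreq ε hε).and_eventually h1).exists
      exact hk' (max_eq_right hk.le)
    rwa [hlε] at hl
  rw [Metric.tendsto_atTop]
  intro ε hε
  obtain ⟨N, hN⟩ := Metric.tendsto_atTop.1 (key (ε / 2) (by positivity)) (ε / 2) (by positivity)
  refine ⟨N, fun k hk => ?_⟩
  have h1 := hN k hk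
  rw [Real.dist_eq, abs_lt] at h1
  rw [Real.dist_eq, sub_zero, abs_of_nonneg (hh k)]
  linarith [le_max_left (h k) (ε / 2)]

/-! ### Accuracy events and expected decrease of the potential -/

namespace Constants

variable (c : Constants)

/-- Coefficient of the decrease of the potential in an iteration with accurate gradient and
estimates. -/
def rate : ℝ := min (c.decrease / 2) c.sigma

/-- Admissible probability of an inaccurate gradient, and of inaccurate estimates: small enough for
the expected growth of the potential to be outweighed by its expected decrease. -/
def slack : ℝ := min (1 / 4) (c.rate / (4 * (c.growth * c.zeta)))

variable {c}

lemma Admissible.rate_pos (hc : c.Admissible) : 0 < c.rate :=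
  lt_min (half_pos hc.decrease_pos) hc.sigma_pos

lemma Admissible.growth_mul_zeta_pos (hc : c.Admissible) : 0 < c.growth * c.zeta :=
  mul_pos hc.growth_pos (zero_lt_one.trans_le hc.one_le_zeta)

lemma Admissible.slack_pos (hc : c.Admissible) : 0 < c.slack :=
  lt_min (by norm_num) (div_pos hc.rate_pos (mul_pos (by norm_num) hc.growth_mul_zeta_pos))

lemma slack_le : c.slack ≤ 1 / 4 := min_le_left _ _

lemma Admissible.growth_mul_zeta_mul_slack_le (hc : c.Admissible) :
    c.growth * c.zeta * c.slack ≤ c.rate / 4 := by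
  have h1 := hc.growth_pos
  have h2 : 0 < c.zeta := zero_lt_one.trans_le hc.one_le_zeta
  calc _ ≤ c.growth * c.zeta * (c.rate / (4 * (c.growth * c.zeta))) := by
        gcongr; exact min_le_right _ _
    _ = _ := by field_simp

end Constants

lemma gradient_fineModel {n : ℕ} (fk : ℝ) (g x y : Vec n) : gradient (fineModel fk g x) y = g := by
  apply HasGradientAt.gradient
  rw [hasGradientAt_iff_hasFDerivAt]
  have h := ((innerSL ℝ g).hasFDerivAt.comp y ((hasFDerivAt_id y).sub_const x)).const_add fk
  refine h.congr_fderiv ?_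
  ext v
  simp

lemma FullyLinear.norm_gradient_sub_le {n : ℕ} {κf κg fk lam : ℝ} {f : Vec n → ℝ} {g x : Vec n}
    (h : FullyLinear κf κg f (fineModel fk g x) x lam) : ‖gradient f x - g‖ ≤ κg / lam := by
  have := (Eventually.self_of_nhds h).1
  rwa [gradient_fineModel] at this

section Trajectory

variable {Ω : Type u} {n nc : ℕ} {c : Constants} {f : Vec n → ℝ} {x0 : Vec n} {lam0 : ℝ}
  {D : ℕ → Ω → IterData n nc}

/-- The event that the gradient approximation of iteration `k` is accurate. It contains the event
that the fine model is fully linear, and does not involve the function estimates. -/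
def accurateGradient (c : Constants) (f : Vec n → ℝ) (x0 : Vec n) (lam0 : ℝ)
    (D : ℕ → Ω → IterData n nc) (k : ℕ) : Set Ω :=
  {ω | ‖gradient f (X c x0 lam0 D k ω) - (D k ω).g‖ ≤ c.kappag / Lam c x0 lam0 D k ω}

/-- The event that the function estimates of iteration `k` are accurate. -/
def accurateEstimates (c : Constants) (f : Vec n → ℝ) (x0 : Vec n) (lam0 : ℝ)
    (D : ℕ → Ω → IterData n nc) (k : ℕ) : Set Ω :=
  {ω | AccurateEstimates c.epsf f (X c x0 lam0 D k ω) (S c x0 lam0 D k ω)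
    (Lam c x0 lam0 D k ω) (D k ω).fk (D k ω).fks}

/-- The scale of the change of the potential in iteration `k`: `‖∇f(X)‖ / Λ` if the gradient is
large compared to `1 / Λ`, and `1 / Λ ^ 2` otherwise. -/
def weight (c : Constants) (f : Vec n → ℝ) (x0 : Vec n) (lam0 : ℝ)
    (D : ℕ → Ω → IterData n nc) (k : ℕ) (ω : Ω) : ℝ :=
  if c.zeta * (1 / Lam c x0 lam0 D k ω) ≤ ‖gradient f (X c x0 lam0 D k ω)‖ then
    ‖gradient f (X c x0 lam0 D k ω)‖ * (1 / Lam c x0 lam0 D k ω)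
  else 1 / Lam c x0 lam0 D k ω ^ 2

lemma one_div_Lam_sq_le_weight (hc : c.Admissible) (hlam0 : 0 < lam0) (k : ℕ) (ω : Ω) :
    1 / Lam c x0 lam0 D k ω ^ 2 ≤ weight c f x0 lam0 D k ω := by
  have h0 := Lam_pos (x0 := x0) (D := D) hc hlam0 k ω
  have hz := hc.one_le_zeta
  unfold weight
  split_ifs with h
  · have hδ : 0 < 1 / Lam c x0 lam0 D k ω := by positivity
    calc 1 / Lam c x0 lam0 D k ω ^ 2
        = 1 / Lam c x0 lam0 D k ω * (1 / Lam c x0 lam0 D k ω) := by ring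
      _ ≤ _ := by gcongr; nlinarith
  · exact le_rfl

lemma weight_nonneg (hc : c.Admissible) (hlam0 : 0 < lam0) (k : ℕ) (ω : Ω) :
    0 ≤ weight c f x0 lam0 D k ω :=
  le_trans (by positivity) (one_div_Lam_sq_le_weight hc hlam0 k ω)

/-- The change of the potential in one iteration: a decrease if gradient and estimates are
accurate, no increase if the estimates are, and a controlled increase otherwise. -/
lemma potential_state_succ_sub_le (hc : c.Admissible) (hlam0 : 0 < lam0)
    (hstep : StepAssumptions c x0 lam0 D) (hsm : SmoothnessAssumptions c f D) (k : ℕ) (ω : Ω) :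
    potential c f (state c x0 lam0 D (k + 1) ω) - potential c f (state c x0 lam0 D k ω) ≤
      -c.rate * (weight c f x0 lam0 D k ω *
        (accurateGradient c f x0 lam0 D k ∩ accurateEstimates c f x0 lam0 D k).indicator
          (fun _ => (1 : ℝ)) ω) +
      c.growth * c.zeta * (weight c f x0 lam0 D k ω - weight c f x0 lam0 D k ω *
        (accurateEstimates c f x0 lam0 D k).indicator (fun _ => (1 : ℝ)) ω) := by
  have hlam := Lam_pos (x0 := x0) (D := D) hc hlam0 k ω
  have hW := weight_nonneg (f := f) (x0 := x0) (D := D) hc hlam0 k ω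
  have hδW := one_div_Lam_sq_le_weight (f := f) (x0 := x0) (D := D) hc hlam0 k ω
  have hreg := regular hstep hsm k ω
  have hf := hsm.contDiff_f.differentiable one_ne_zero
  have hL := hsm.lipschitz_f
  have hr := hc.rate_pos
  have hrs : c.rate ≤ c.sigma := min_le_right _ _
  have hrd : c.rate ≤ c.decrease / 2 := min_le_left _ _
  have hz := hc.one_le_zeta
  change potential c f ((D k ω).next c (X c x0 lam0 D k ω, Lam c x0 lam0 D k ω)) -
    potential c f (X c x0 lam0 D k ω, Lam c x0 lam0 D k ω) ≤ _
  by_cases hJ : ω ∈ accurateEstimates c f x0 lam0 D k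
  · have h1 := hreg.potential_next_le_of_accurate (f := f) hc hlam hJ
    have hδ : 0 ≤ 1 / Lam c x0 lam0 D k ω ^ 2 := by positivity
    by_cases hI : ω ∈ accurateGradient c f x0 lam0 D k
    · simp only [Set.indicator_of_mem (Set.mem_inter hI hJ), Set.indicator_of_mem hJ, mul_one,
        sub_self, mul_zero, add_zero]
      by_cases hbig : c.zeta * (1 / Lam c x0 lam0 D k ω) ≤ ‖gradient f (X c x0 lam0 D k ω)‖
      · have h2 := (hreg.successful_and_potential_next_le hc hf hL hlam hI hJ hbig).2
        have h3 : weight c f x0 lam0 D k ω = _ := if_pos hbig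
        rw [← h3] at h2
        nlinarith
      · have h3 : weight c f x0 lam0 D k ω = _ := if_neg hbig
        rw [h3]
        nlinarith
    · rw [Set.indicator_of_notMem (fun h => hI h.1), Set.indicator_of_mem hJ]
      nlinarith [hc.sigma_pos, mul_nonneg hc.sigma_pos.le hδ]
  · rw [Set.indicator_of_notMem (fun h => hJ h.2), Set.indicator_of_notMem hJ]
    simp only [mul_zero, sub_zero, zero_add]
    refine (hreg.potential_next_le hc hf hL hlam).trans ?_
    have hK := hc.one_le_stepBound
    have hd := hc.decrease_pos
    have h2 : ‖gradient f (X c x0 lam0 D k ω)‖ * (1 / Lam c x0 lam0 D k ω) ≤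
        c.zeta * weight c f x0 lam0 D k ω := by
      unfold weight
      split_ifs with h
      · exact le_mul_of_one_le_left (by positivity) hz
      · calc _ ≤ c.zeta * (1 / Lam c x0 lam0 D k ω) * (1 / Lam c x0 lam0 D k ω) := by
              gcongr; exact (not_le.1 h).le
          _ = _ := by ring
    have h3 : 1 / Lam c x0 lam0 D k ω ^ 2 ≤ c.zeta * weight c f x0 lam0 D k ω :=
      hδW.trans (le_mul_of_one_le_left hW hz)
    calc _ ≤ c.stepBound * (c.zeta * weight c f x0 lam0 D k ω) +
          (c.Lf / 2 * c.stepBound ^ 2 + c.decrease / 2) *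
            (c.zeta * weight c f x0 lam0 D k ω) := by gcongr
      _ = _ := by unfold Constants.growth; ring

lemma measurable_gradient_X (hsm : SmoothnessAssumptions c f D) (k : ℕ) :
    Measurable[past D k] fun ω => gradient f (X c x0 lam0 D k ω) :=
  hsm.lipschitz_f.continuous.measurable.comp (measurable_X hsm.contDiff_phi k)

lemma measurable_weight (hsm : SmoothnessAssumptions c f D) (k : ℕ) :
    Measurable[past D k] (weight c f x0 lam0 D k) := by
  let _ : MeasurableSpace Ω := past D k
  have h1 := (measurable_gradient_X (c := c) (x0 := x0) (lam0 := lam0) hsm k).norm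
  have h2 := measurable_Lam (c := c) (x0 := x0) (lam0 := lam0) hsm.contDiff_phi k
  have h3 : Measurable[past D k] fun ω => 1 / Lam c x0 lam0 D k ω := h2.const_div 1
  exact Measurable.ite (measurableSet_le (h3.const_mul _) h1) (h1.mul h3)
    ((h2.pow_const 2).const_div 1)

lemma measurableSet_accurateGradient (hsm : SmoothnessAssumptions c f D) (k : ℕ) :
    MeasurableSet[past D (k + 1)] (accurateGradient c f x0 lam0 D k) := by
  let _ : MeasurableSpace Ω := past D (k + 1)
  have h1 := (measurable_gradient_X (x0 := x0) (lam0 := lam0) hsm k).mono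
    (past_mono D k.le_succ) le_rfl
  have h2 := (measurable_Lam (c := c) (x0 := x0) (lam0 := lam0) hsm.contDiff_phi k).mono
    (past_mono D k.le_succ) le_rfl
  have h3 := (@measurable_of_modelSigma_le Ω (past D (k + 1)) n nc (D k)
    (modelSigma_le_past_succ D k)).2.2.1
  exact measurableSet_le (h1.sub h3).norm (h2.const_div _)

lemma measurableSet_accurateEstimates (hsm : SmoothnessAssumptions c f D) (k : ℕ) :
    MeasurableSet[past D (k + 1)] (accurateEstimates c f x0 lam0 D k) := by
  let _ : MeasurableSpace Ω := past D (k + 1)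
  have h1 := (measurable_X (c := c) (x0 := x0) (lam0 := lam0) hsm.contDiff_phi k).mono
    (past_mono D k.le_succ) le_rfl
  have h2 := (measurable_Lam (c := c) (x0 := x0) (lam0 := lam0) hsm.contDiff_phi k).mono
    (past_mono D k.le_succ) le_rfl
  have h3 := @measurable_step Ω (past D (k + 1)) n nc (D k) _ (modelSigma_le_past_succ D k) h2
  obtain ⟨h4, h5⟩ := @measurable_of_estimateSigma_le Ω (past D (k + 1)) n nc (D k)
    (estimateSigma_le_past_succ D k)
  have hf := hsm.contDiff_f.continuous.measurable
  have h6 := (h2.pow_const 2).const_div c.epsf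
  exact (measurableSet_le (h4.sub (hf.comp h1)).abs h6).inter
    (measurableSet_le (h5.sub (hf.comp (h1.add h3))).abs h6)

lemma exists_weight_le (hc : c.Admissible) (hlam0 : 0 < lam0) (hstep : StepAssumptions c x0 lam0 D)
    (hsm : SmoothnessAssumptions c f D) (k : ℕ) : ∃ M, ∀ ω, weight c f x0 lam0 D k ω ≤ M := by
  obtain ⟨M, hM⟩ := exists_norm_X_le hc hlam0 hstep hsm k
  obtain ⟨B, hB⟩ := (isCompact_closedBall (0 : Vec n) M).exists_bound_of_continuousOn
    hsm.lipschitz_f.continuous.continuousOn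
  have hγ := hc.gamma_pos
  refine ⟨max (B * (1 / (c.gamma ^ k * lam0))) (1 / (c.gamma ^ k * lam0) ^ 2), fun ω => ?_⟩
  have h1 := gamma_pow_mul_le_Lam (x0 := x0) (D := D) hc hlam0 k ω
  have h2 := hB (X c x0 lam0 D k ω) (mem_closedBall_zero_iff.2 (hM ω))
  have h3 := (norm_nonneg _).trans h2
  have h4 : 0 < c.gamma ^ k * lam0 := by positivity
  have h5 : 0 < Lam c x0 lam0 D k ω := h4.trans_le h1
  unfold weight
  split_ifs
  · exact le_max_of_le_left (by gcongr)
  · exact le_max_of_le_right (by gcongr)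

section Measure

variable [mΩ : MeasurableSpace Ω] {μ : Measure Ω} [IsProbabilityMeasure μ]

lemma integrable_weight (hc : c.Admissible) (hlam0 : 0 < lam0)
    (hmod : ∀ k, modelSigma (D k) ≤ mΩ) (hest : ∀ k, estimateSigma (D k) ≤ mΩ)
    (hstep : StepAssumptions c x0 lam0 D) (hsm : SmoothnessAssumptions c f D) (k : ℕ) :
    Integrable (weight c f x0 lam0 D k) μ := by
  obtain ⟨M, hM⟩ := exists_weight_le hc hlam0 hstep hsm k
  refine Integrable.of_bound
    ((measurable_weight hsm k).mono (past_le hmod hest k) le_rfl).aestronglyMeasurable M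
    (ae_of_all _ fun ω => ?_)
  rw [Real.norm_of_nonneg (weight_nonneg hc hlam0 k ω)]
  exact hM ω

lemma integrable_potential_state (hc : c.Admissible) (hlam0 : 0 < lam0)
    (hmod : ∀ k, modelSigma (D k) ≤ mΩ) (hest : ∀ k, estimateSigma (D k) ≤ mΩ)
    (hstep : StepAssumptions c x0 lam0 D) (hsm : SmoothnessAssumptions c f D) (k : ℕ) :
    Integrable (fun ω => potential c f (state c x0 lam0 D k ω)) μ := by
  have hX := (measurable_X (c := c) (x0 := x0) (lam0 := lam0) hsm.contDiff_phi k).mono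
    (past_le hmod hest k) le_rfl
  have hΛ := (measurable_Lam (c := c) (x0 := x0) (lam0 := lam0) hsm.contDiff_phi k).mono
    (past_le hmod hest k) le_rfl
  obtain ⟨M, hM⟩ := exists_norm_X_le hc hlam0 hstep hsm k
  obtain ⟨B, hB⟩ := (isCompact_closedBall (0 : Vec n) M).exists_bound_of_continuousOn
    hsm.contDiff_f.continuous.continuousOn
  have hγ := hc.gamma_pos
  have hτ := hc.tau_pos
  have h4 : 0 < c.gamma ^ k * lam0 := by positivity
  refine Integrable.add (Integrable.of_bound
    (hsm.contDiff_f.continuous.measurable.comp hX).aestronglyMeasurable B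
    (ae_of_all _ fun ω => hB _ (mem_closedBall_zero_iff.2 (hM ω)))) (Integrable.of_bound
    ((hΛ.pow_const 2).const_div c.tau).aestronglyMeasurable (c.tau / (c.gamma ^ k * lam0) ^ 2)
    (ae_of_all _ fun ω => ?_))
  rw [Real.norm_of_nonneg (by positivity)]
  gcongr
  exact gamma_pow_mul_le_Lam hc hlam0 k ω

/-- If gradients and estimates are accurate with conditional probabilities close enough to one,
then the potential decreases in expectation, and hence the weights are almost surely summable. -/
lemma ae_summable_weight (hc : c.Admissible) (hlam0 : 0 < lam0)
    (hmod : ∀ k, modelSigma (D k) ≤ mΩ) (hest : ∀ k, estimateSigma (D k) ≤ mΩ)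
    (hstep : StepAssumptions c x0 lam0 D) (hsm : SmoothnessAssumptions c f D)
    (hI : ∀ k, ∀ᵐ ω ∂μ, 1 - c.slack ≤ (μ⟦accurateGradient c f x0 lam0 D k | past D k⟧) ω)
    (hJ : ∀ k, ∀ᵐ ω ∂μ, 1 - c.slack ≤ (μ⟦accurateEstimates c f x0 lam0 D k | past D k⟧) ω) :
    ∀ᵐ ω ∂μ, Summable fun k => weight c f x0 lam0 D k ω := by
  obtain ⟨b, hb⟩ := hsm.bddBelow_f
  have hr := hc.rate_pos
  have hWi := integrable_weight (μ := μ) hc hlam0 hmod hest hstep hsm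
  have hΦi := integrable_potential_state (μ := μ) hc hlam0 hmod hest hstep hsm
  have hdec : ∀ k, c.rate / 4 * ∫ ω, weight c f x0 lam0 D k ω ∂μ ≤
      ∫ ω, potential c f (state c x0 lam0 D k ω) ∂μ -
        ∫ ω, potential c f (state c x0 lam0 D (k + 1) ω) ∂μ := by
    intro k
    have hIm := past_le hmod hest (k + 1) _ (measurableSet_accurateGradient (x0 := x0)
      (lam0 := lam0) hsm k)
    have hJm := past_le hmod hest (k + 1) _ (measurableSet_accurateEstimates (x0 := x0)
      (lam0 := lam0) hsm k)
    obtain ⟨M, hM⟩ := exists_weight_le hc hlam0 hstep hsm k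
    have hW0 := weight_nonneg (f := f) (x0 := x0) (D := D) hc hlam0 k
    have h1 := le_integral_mul_indicator (past_le hmod hest k) (hIm.inter hJm)
      (measurable_weight hsm k) hW0 hM
      (le_condExp_indicator_inter (past_le hmod hest k) hIm hJm (hI k) (hJ k))
    have h2 := le_integral_mul_indicator (past_le hmod hest k) hJm
      (measurable_weight hsm k) hW0 hM (hJ k)
    have hprod : ∀ A : Set Ω, MeasurableSet A → Integrable (fun ω =>
        weight c f x0 lam0 D k ω * A.indicator (fun _ => (1 : ℝ)) ω) μ := by
      intro A hA
      refine ((hWi k).indicator hA).congr (ae_of_all _ fun ω => ?_)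
      by_cases h : ω ∈ A <;> simp [h]
    have hgap : Integrable (fun ω => weight c f x0 lam0 D k ω - weight c f x0 lam0 D k ω *
        (accurateEstimates c f x0 lam0 D k).indicator (fun _ => (1 : ℝ)) ω) μ :=
      (hWi k).sub (hprod _ hJm)
    have h3 := integral_mono ((hΦi (k + 1)).sub (hΦi k))
      (((hprod _ (hIm.inter hJm)).const_mul (-c.rate)).add
        (hgap.const_mul (c.growth * c.zeta)))
      (potential_state_succ_sub_le hc hlam0 hstep hsm k)
    simp only [Pi.add_apply, Pi.sub_apply] at h3
    rw [integral_sub (hΦi _) (hΦi _), integral_add ((hprod _ (hIm.inter hJm)).const_mul _)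
      (hgap.const_mul _), integral_const_mul, integral_const_mul,
      integral_sub (hWi k) (hprod _ hJm)] at h3
    have hW : 0 ≤ ∫ ω, weight c f x0 lam0 D k ω ∂μ := integral_nonneg hW0
    set w := ∫ ω, weight c f x0 lam0 D k ω ∂μ
    have h4 := mul_le_mul_of_nonneg_left h1 hr.le
    have h5 := mul_le_mul_of_nonneg_left h2 hc.growth_mul_zeta_pos.le
    have h6 := mul_le_mul_of_nonneg_right hc.growth_mul_zeta_mul_slack_le hW
    have h7 : c.rate * (1 / 2 * w) ≤ c.rate * ((1 - c.slack + (1 - c.slack) - 1) * w) := by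
      have := c.slack_le
      gcongr
      linarith
    linarith
  refine ae_summable_of_sum_integral_le
    (C := (4 / c.rate) * (potential c f (x0, lam0) - b)) hWi (weight_nonneg hc hlam0) fun N => ?_
  have h1 : c.rate / 4 * ∑ k ∈ Finset.range N, ∫ ω, weight c f x0 lam0 D k ω ∂μ ≤
      potential c f (x0, lam0) - b := by
    rw [Finset.mul_sum]
    refine (Finset.sum_le_sum fun k _ => hdec k).trans ?_
    rw [Finset.sum_range_sub']
    have h2 : ∫ ω, potential c f (state c x0 lam0 D 0 ω) ∂μ = potential c f (x0, lam0) := by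
      simp [state]
    have h3 : b ≤ ∫ ω, potential c f (state c x0 lam0 D N ω) ∂μ := by
      have h4 : ∫ _, b ∂μ ≤ ∫ ω, potential c f (state c x0 lam0 D N ω) ∂μ := by
        refine integral_mono (integrable_const b) (hΦi N) fun ω => ?_
        have h5 : b ≤ f (state c x0 lam0 D N ω).1 := hb ⟨_, rfl⟩
        have h6 : 0 ≤ c.tau / (state c x0 lam0 D N ω).2 ^ 2 :=
          div_nonneg hc.tau_pos.le (sq_nonneg _)
        simp only [potential]
        linarith
      simpa using h4
    rw [h2]
    linarith
  calc _ = 4 / c.rate * (c.rate / 4 * _) := by field_simp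
    _ ≤ _ := by gcongr

end Measure

/-! ### Convergence along a trajectory -/

/-- The walk counting accurate against inaccurate iterations up to time `N`. -/
def accuracyWalk (c : Constants) (f : Vec n → ℝ) (x0 : Vec n) (lam0 : ℝ)
    (D : ℕ → Ω → IterData n nc) (ω : Ω) (N : ℕ) : ℝ :=
  ∑ k ∈ Finset.range N, (2 * (accurateGradient c f x0 lam0 D k ∩
    accurateEstimates c f x0 lam0 D k).indicator (fun _ => (1 : ℝ)) ω - 1)

/-- As long as the gradient is large compared to `1 / Λ`, each accurate iteration is successful, so
that `log Λ` decreases at least as fast as the walk increases. -/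
lemma log_Lam_sub_walk_succ_le (hc : c.Admissible) (hlam0 : 0 < lam0)
    (hstep : StepAssumptions c x0 lam0 D) (hsm : SmoothnessAssumptions c f D) {k : ℕ} {ω : Ω}
    (hbig : c.zeta * (1 / Lam c x0 lam0 D k ω) ≤ ‖gradient f (X c x0 lam0 D k ω)‖) :
    Real.log (Lam c x0 lam0 D (k + 1) ω) -
        Real.log c.gamma * accuracyWalk c f x0 lam0 D ω (k + 1) ≤
      Real.log (Lam c x0 lam0 D k ω) - Real.log c.gamma * accuracyWalk c f x0 lam0 D ω k := by
  have hlam := Lam_pos (x0 := x0) (D := D) hc hlam0 k ω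
  have hlog := Real.log_neg hc.gamma_pos hc.gamma_lt_one
  have hγ := hc.gamma_pos.ne'
  simp only [accuracyWalk, Finset.sum_range_succ]
  by_cases hG : ω ∈ accurateGradient c f x0 lam0 D k ∩ accurateEstimates c f x0 lam0 D k
  · have hs := ((regular hstep hsm k ω).successful_and_potential_next_le hc
      (hsm.contDiff_f.differentiable one_ne_zero) hsm.lipschitz_f hlam hG.1 hG.2 hbig).1
    have h1 : state c x0 lam0 D (k + 1) ω = _ := IterData.next_of_successful hs
    have h2 : Lam c x0 lam0 D (k + 1) ω = c.gamma * Lam c x0 lam0 D k ω := congrArg Prod.snd h1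
    rw [h2, Real.log_mul hγ hlam.ne', Set.indicator_of_mem hG]
    linarith
  · rw [Set.indicator_of_notMem hG]
    rcases Lam_succ (c := c) (x0 := x0) (lam0 := lam0) (D := D) k ω with h | h
    · rw [h, Real.log_mul hγ hlam.ne']
      linarith
    · rw [h, Real.log_mul (inv_ne_zero hγ) hlam.ne', Real.log_inv]
      linarith

lemma tendsto_one_div_Lam (hc : c.Admissible) (hlam0 : 0 < lam0) {ω : Ω}
    (hsum : Summable fun k => weight c f x0 lam0 D k ω) :
    Tendsto (fun k => 1 / Lam c x0 lam0 D k ω) atTop (𝓝 0) := by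
  have h1 : Summable fun k => 1 / Lam c x0 lam0 D k ω ^ 2 :=
    hsum.of_nonneg_of_le (fun k => by positivity)
      fun k => one_div_Lam_sq_le_weight hc hlam0 k ω
  have h2 := h1.tendsto_atTop_zero.sqrt
  rw [Real.sqrt_zero] at h2
  refine h2.congr fun k => ?_
  rw [← one_div_pow, Real.sqrt_sq]
  exact one_div_nonneg.2 (Lam_pos hc hlam0 k ω).le

/-- If the gradient stayed away from zero, then `log Λ` would eventually be bounded above by a
constant minus a multiple of the walk, contradicting `Λ → ∞`. -/
lemma frequently_norm_gradient_lt (hc : c.Admissible) (hlam0 : 0 < lam0)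
    (hstep : StepAssumptions c x0 lam0 D) (hsm : SmoothnessAssumptions c f D) {ω : Ω}
    (hsum : Summable fun k => weight c f x0 lam0 D k ω)
    (hwalk : ¬ BddAbove (Set.range (accuracyWalk c f x0 lam0 D ω))) {ε : ℝ} (hε : 0 < ε) :
    ∃ᶠ k in atTop, ‖gradient f (X c x0 lam0 D k ω)‖ < ε := by
  by_contra hcon
  rw [not_frequently] at hcon
  have hδ := tendsto_one_div_Lam hc hlam0 hsum
  have hζδ : ∀ᶠ k in atTop, c.zeta * (1 / Lam c x0 lam0 D k ω) < ε := by
    have := hδ.const_mul c.zeta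
    rw [mul_zero] at this
    exact this.eventually_lt_const hε
  obtain ⟨N, hN⟩ := eventually_atTop.1
    (hcon.and (hζδ.and (hδ.eventually_lt_const zero_lt_one)))
  have hanti : ∀ k, N ≤ k → Real.log (Lam c x0 lam0 D k ω) -
      Real.log c.gamma * accuracyWalk c f x0 lam0 D ω k ≤
      Real.log (Lam c x0 lam0 D N ω) - Real.log c.gamma * accuracyWalk c f x0 lam0 D ω N := by
    intro k hk
    induction k, hk using Nat.le_induction with
    | base => exact le_rfl
    | succ k hk ih =>
      refine (log_Lam_sub_walk_succ_le hc hlam0 hstep hsm ?_).trans ih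
      exact (hN k hk).2.1.le.trans (not_lt.1 (hN k hk).1)
  have hlog := Real.log_neg hc.gamma_pos hc.gamma_lt_one
  apply hwalk
  have hev : IsBoundedUnder (· ≤ ·) atTop (accuracyWalk c f x0 lam0 D ω) := by
    refine isBoundedUnder_of_eventually_le (a := (Real.log (Lam c x0 lam0 D N ω) -
      Real.log c.gamma * accuracyWalk c f x0 lam0 D ω N) / (-Real.log c.gamma)) ?_
    filter_upwards [eventually_ge_atTop N] with k hk
    have h1 := hanti k hk
    have h2 := (hN k hk).2.2
    rw [div_lt_one (Lam_pos hc hlam0 k ω)] at h2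
    have h3 := Real.log_pos h2
    rw [le_div_iff₀ (neg_pos.2 hlog)]
    linarith
  exact hev.bddAbove_range

lemma tendsto_norm_gradient (hc : c.Admissible) (hlam0 : 0 < lam0)
    (hstep : StepAssumptions c x0 lam0 D) (hsm : SmoothnessAssumptions c f D) {ω : Ω}
    (hsum : Summable fun k => weight c f x0 lam0 D k ω)
    (hwalk : ¬ BddAbove (Set.range (accuracyWalk c f x0 lam0 D ω))) :
    Tendsto (fun k => ‖gradient f (X c x0 lam0 D k ω)‖) atTop (𝓝 0) := by
  have hK : 0 ≤ c.stepBound := zero_le_one.trans hc.one_le_stepBound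
  have hlam := Lam_pos (x0 := x0) (D := D) hc hlam0
  have hδ := tendsto_one_div_Lam hc hlam0 hsum
  have hC : 0 ≤ (c.Lf : ℝ) * c.stepBound := by positivity
  refine tendsto_zero_of_summable_indicator
    (δ := fun k => c.Lf * c.stepBound * (1 / Lam c x0 lam0 D k ω)) (K := c.gamma⁻¹)
    (fun k => norm_nonneg _) (fun k => mul_nonneg hC (one_div_nonneg.2 (hlam k ω).le))
    (fun k => ?_) (fun k => ?_) (fun ε hε => ?_)
    fun ε hε => frequently_norm_gradient_lt hc hlam0 hstep hsm hsum hwalk hε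
  · calc _ ≤ ‖gradient f (X c x0 lam0 D (k + 1) ω) - gradient f (X c x0 lam0 D k ω)‖ :=
          abs_norm_sub_norm_le _ _
      _ ≤ c.Lf * ‖X c x0 lam0 D (k + 1) ω - X c x0 lam0 D k ω‖ :=
          hsm.lipschitz_f.norm_sub_le _ _
      _ ≤ c.Lf * (c.stepBound * (1 / Lam c x0 lam0 D k ω)) := by
          gcongr; exact norm_X_succ_sub_le hc hlam0 hstep hsm k ω
      _ = _ := by ring
  · have h1 := Lam_succ_le (x0 := x0) (D := D) hc hlam0 k ω
    have h2 := hlam k ω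
    have h3 := hlam (k + 1) ω
    have hγ := hc.gamma_pos
    calc c.Lf * c.stepBound * (1 / Lam c x0 lam0 D k ω)
        = c.Lf * c.stepBound * (c.gamma⁻¹ * (1 / (c.gamma⁻¹ * Lam c x0 lam0 D k ω))) := by
          field_simp
      _ ≤ c.Lf * c.stepBound * (c.gamma⁻¹ * (1 / Lam c x0 lam0 D (k + 1) ω)) := by gcongr
      _ = _ := by ring
  · have hζδ : ∀ᶠ k in atTop, c.zeta * (1 / Lam c x0 lam0 D k ω) < ε := by
      have := hδ.const_mul c.zeta
      rw [mul_zero] at this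
      exact this.eventually_lt_const hε
    refine Summable.of_norm_bounded_eventually_nat
      (hsum.mul_left (c.Lf * c.stepBound / ε)) ?_
    filter_upwards [hζδ] with k hk
    have hδk : 0 ≤ 1 / Lam c x0 lam0 D k ω := one_div_nonneg.2 (hlam k ω).le
    split_ifs with h
    · have h1 : weight c f x0 lam0 D k ω = _ := if_pos (hk.le.trans h)
      rw [Real.norm_of_nonneg (mul_nonneg hC hδk), h1]
      calc c.Lf * c.stepBound * (1 / Lam c x0 lam0 D k ω)
          = c.Lf * c.stepBound / ε * (ε * (1 / Lam c x0 lam0 D k ω)) := by field_simp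
        _ ≤ _ := by gcongr
    · rw [norm_zero]
      exact mul_nonneg (by positivity) (weight_nonneg hc hlam0 k ω)

end Trajectory

end

end MU2STREG

theorem mainTheorem2 (c : Constants) (hc : c.Admissible) :
    ∃ α₀ β₀ : ℝ, 0 < α₀ ∧ α₀ < 1 ∧ 0 < β₀ ∧ β₀ < 1 ∧
      ∀ α β : ℝ, α₀ ≤ α → α < 1 → β₀ ≤ β → β < 1 →
      ∀ (Ω : Type u) [MeasurableSpace Ω] (μ : Measure Ω) [IsProbabilityMeasure μ]
        (n nc : ℕ) (f : Vec n → ℝ) (x0 : Vec n) (lam0 : ℝ) (D : ℕ → Ω → IterData n nc),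
        0 < lam0 →
        (∀ k, modelSigma (D k) ≤ ‹MeasurableSpace Ω›) →
        (∀ k, estimateSigma (D k) ≤ ‹MeasurableSpace Ω›) →
        StepAssumptions c x0 lam0 D →
        SmoothnessAssumptions c f D →
        ProbFullyLinear μ α c f x0 lam0 D →
        ProbAccurate μ β c f x0 lam0 D →
        ∀ᵐ ω ∂μ, Tendsto (fun k => ‖gradient f (X c x0 lam0 D k ω)‖) atTop (𝓝 0) := by
  have hs := hc.slack_pos
  have hs' := c.slack_le
  refine ⟨1 - c.slack, 1 - c.slack, by linarith, by linarith, by linarith, by linarith, ?_⟩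
  intro α β hα _ hβ _ Ω mΩ μ _ n nc f x0 lam0 D hlam0 hmod hest hstep hsm hFL hAcc
  have hIm := fun k => past_le hmod hest (k + 1) _
    (measurableSet_accurateGradient (x0 := x0) (lam0 := lam0) hsm k)
  have hJm := fun k => past_le hmod hest (k + 1) _
    (measurableSet_accurateEstimates (x0 := x0) (lam0 := lam0) hsm k)
  have hI : ∀ k, ∀ᵐ ω ∂μ,
      1 - c.slack ≤ (μ⟦accurateGradient c f x0 lam0 D k | past D k⟧) ω := fun k =>
    le_condExp_indicator_of_subset (by linarith) (hIm k)
      (fun _ h => FullyLinear.norm_gradient_sub_le h) ((hFL k).mono fun _ h => hα.trans h)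
  -- tower property: the past is contained in the past augmented by the current model
  have hJ : ∀ k, ∀ᵐ ω ∂μ,
      1 - c.slack ≤ (μ⟦accurateEstimates c f x0 lam0 D k | past D k⟧) ω := fun k =>
    le_condExp_of_le le_sup_left (sup_le (past_le hmod hest k) (hmod k))
      ((hAcc k).mono fun _ h => hβ.trans h)
  let ℱ : Filtration ℕ mΩ := ⟨past D, past_mono D, past_le hmod hest⟩
  -- both events hold with conditional probability at least `1 - 2 * slack ≥ 1 / 2`
  have hwalk := ae_not_bddAbove_walk (μ := μ) ℱ
    (A := fun k => accurateGradient c f x0 lam0 D k ∩ accurateEstimates c f x0 lam0 D k)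
    (fun k => (measurableSet_accurateGradient hsm k).inter (measurableSet_accurateEstimates hsm k))
    (fun k => (le_condExp_indicator_inter (past_le hmod hest k) (hIm k) (hJm k) (hI k)
      (hJ k)).mono fun _ h => le_trans (by linarith) h)
  filter_upwards [ae_summable_weight hc hlam0 hmod hest hstep hsm hI hJ, hwalk] with ω h1 h2
  exact tendsto_norm_gradient hc hlam0 hstep hsm h1 h2
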